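/- Let $r \ge 2$ be an integer (even or odd) and let $d(x) = \min_{n \in \mathbb{Z}} |x-n|$ be the distance from $x \in \mathbb{R}$ to the nearest integer. Let $(a_k)_{k \ge 1}$ be a real sequence with $$\sum_{k=1}^{\infty} \left|\frac{a_k}{r^{k-1}}\right| < \infty,$$ and define $f_{r,a} : \mathbb{R} \to \mathbb{R}$ by $$f_{r,a}(x) = \sum_{k=1}^{\infty} \frac{a_k}{r^{k-1}}\, d(r^{k-1}x).$$ Then $f_{r,a}$ is continuous, and the following hold, where "almost every" refers to Lebesgue measure. (i) If $\sum_{k=1}^{\infty} a_k^2 < \infty$, then $f_{r,a}$ is absolutely continuous on every compact interval, and hence differentiable at almost every $x \in \mathbb{R}$. (ii) If $\sum_{k=1}^{\infty} a_k^2 = \infty$ but $\lim_{k\to\infty} a_k = 0$, then the set $D$ of points at which $f_{r,a}$ is differentiable (with finite derivative) has the cardinality of the continuum and $\{ f_{r,a}'(x) : x \in D \} = \mathbb{R}$, but for almost every $x \in \mathbb{R}$ the function $f_{r,a}$ is not differentiable at $x$ (that is, $D$ has Lebesgue measure zero). (iii) If $\limsup_{k\to\infty} |a_k| > 0$ (the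 value $+\infty$ being allowed), then $f_{r,a}$ has a finite derivative at no point $x \in \mathbb{R}$. -/

import Mathlib

open Filter Topology MeasureTheory

/-- The distance from `x` to its nearest integer, `d(x) = min_{n ∈ ℤ} |x - n|`. -/
noncomputable def distInt (x : ℝ) : ℝ := |x - round x|

theorem distInt_isLeast (x : ℝ) : IsLeast (Set.range fun n : ℤ => |x - n|) (distInt x) := by
  refine ⟨⟨round x, rfl⟩, ?_⟩
  rintro _ ⟨n, rfl⟩
  exact round_le x n

/-- `ψ_k(x) = d(r^(k-1) x) / r^(k-1)`; it is only used for `k ≥ 1`. -/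
noncomputable def takagiPsi (r k : ℕ) (x : ℝ) : ℝ :=
  distInt ((r : ℝ) ^ (k - 1) * x) / (r : ℝ) ^ (k - 1)

/-- The Takagi–van der Waerden class function `f_{r,a}(x) = ∑_{k ≥ 1} a_k ψ_k(x)`.
The sum runs over `k + 1` with `k : ℕ`, so the value `a 0` plays no role. -/
noncomputable def takagiVdW (r : ℕ) (a : ℕ → ℝ) (x : ℝ) : ℝ :=
  ∑' k : ℕ, a (k + 1) * takagiPsi r (k + 1) x

/-- The series defining `takagiVdW` converges absolutely at every point. -/
theorem takagiVdW_summable (r : ℕ) (a : ℕ → ℝ)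
    (ha : Summable fun k : ℕ => |a (k + 1) / (r : ℝ) ^ k|) (x : ℝ) :
    Summable fun k : ℕ => |a (k + 1) * takagiPsi r (k + 1) x| := by
  refine Summable.of_nonneg_of_le (fun k => abs_nonneg _) (fun k => ?_) ha
  have h : |distInt ((r : ℝ) ^ k * x)| ≤ 1 := by
    rw [distInt, abs_abs]
    exact (abs_sub_round _).trans (by norm_num)
  have e : a (k + 1) * takagiPsi r (k + 1) x
      = a (k + 1) / (r : ℝ) ^ k * distInt ((r : ℝ) ^ k * x) := by
    simp only [takagiPsi, Nat.add_sub_cancel]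
    ring
  rw [e, abs_mul]
  exact mul_le_of_le_one_right (abs_nonneg _) h

/-! ### The distance to the nearest integer -/

/-! Put `b k = a (k + 1)` and look at the grid of step 1/(2r^n). For k ≤ n, d(r^k x) is affine on
each cell; for k ≥ n its value at a grid point q/(2r^n) depends only on the parity of q. Hence,
whatever the parity of r, the r children of a cell have slopes s ± R with alternating signs, where R
= `adicTail r b (n + 1)` (`cellSlope_succ`), and their mean is the parent's slope. Cell slopes thus
form a martingale with bounded-ratio increments: each refinement adds between 3/4 R² and R² to the
mean square (`sum_cellSlope_succ_sq`). The recurrence `exists_adicTail_recurrence` makes b and R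
interchangeable for limits and square sums.

Case (iii): at a point of differentiability two nearby sibling slopes converge to the derivative,
but they differ by 2|R|, so R and then b tend to 0. Case (i): the slopes are bounded in L² uniformly
in n, and continuity turns this energy bound into absolute continuity (`sum_abs_sub_le_of_energy`).
Case (ii), almost everywhere: stopped on leaving [-K, K], the martingale is bounded, while its
energy would diverge if a positive proportion of cells never stopped. So the slopes are unbounded at
almost every point, which excludes a derivative. Case (ii), range: b → 0 and ∑ |b| = ∞ allow signs
with ∑ σ_k b_k = L. A point whose digits are 0 or r - 1 according to σ_k realises these signs as the
slopes of d at r^k x; if no sign fills a block of three, r^k x stays away from the corners of d, and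
the derivative is L. Surjectivity onto ℝ gives the cardinality. -/

theorem distInt_nonneg (x : ℝ) : 0 ≤ distInt x := abs_nonneg _

theorem distInt_le_half (x : ℝ) : distInt x ≤ 1 / 2 := abs_sub_round x

theorem distInt_add_int (x : ℝ) (m : ℤ) : distInt (x + m) = distInt x := by
  simp [distInt, round_add_intCast]

theorem distInt_int_add (m : ℤ) (x : ℝ) : distInt (m + x) = distInt x := by
  rw [add_comm, distInt_add_int]

theorem distInt_intCast (m : ℤ) : distInt m = 0 := by simp [distInt]

theorem distInt_sub_le (x y : ℝ) : distInt x - distInt y ≤ |x - y| := by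
  have h1 : distInt x ≤ |x - round y| := (distInt_isLeast x).2 ⟨round y, rfl⟩
  have h2 : |x - round y| ≤ |x - y| + |y - round y| := abs_sub_le _ _ _
  have h3 : distInt y = |y - round y| := rfl
  linarith

theorem abs_distInt_sub_le (x y : ℝ) : |distInt x - distInt y| ≤ |x - y| := by
  rw [abs_le]
  constructor
  · have := distInt_sub_le y x
    rw [abs_sub_comm] at this
    linarith
  · exact distInt_sub_le x y

theorem continuous_distInt : Continuous distInt :=
  LipschitzWith.continuous (K := 1) <| LipschitzWith.of_dist_le_mul fun x y => by
    simpa [Real.dist_eq] using abs_distInt_sub_le x y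

theorem distInt_eq_self {y : ℝ} (h0 : 0 ≤ y) (h1 : y ≤ 1 / 2) : distInt y = y := by
  refine le_antisymm ?_ ?_
  · have := (distInt_isLeast y).2 ⟨0, rfl⟩
    simpa [abs_of_nonneg h0] using this
  · obtain ⟨n, hn⟩ := (distInt_isLeast y).1
    rw [← hn]
    rcases le_or_gt n 0 with h | h
    · have : (n : ℝ) ≤ 0 := by exact_mod_cast h
      exact le_trans (by linarith) (le_abs_self _)
    · have : (1 : ℝ) ≤ n := by exact_mod_cast h
      exact le_trans (by linarith) (neg_le_abs _)

theorem distInt_neg (y : ℝ) : distInt (-y) = distInt y := by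
  have h : ∀ z, distInt (-z) ≤ distInt z := fun z => by
    refine (distInt_isLeast (-z)).2 ⟨-round z, ?_⟩
    simp only [distInt, Int.cast_neg]
    rw [← abs_neg]
    congr 1
    ring
  exact le_antisymm (h y) (by simpa using h (-y))

theorem distInt_eq_one_sub {y : ℝ} (h0 : 1 / 2 ≤ y) (h1 : y ≤ 1) : distInt y = 1 - y := by
  have h : distInt y = distInt (1 - y) := by
    rw [← distInt_neg, ← distInt_int_add 1]
    congr 1
    push_cast
    ring
  rw [h, distInt_eq_self (by linarith) (by linarith)]

theorem distInt_affine_on_half (j : ℤ) :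
    ∃ c s : ℝ, ∀ y : ℝ, (j : ℝ) / 2 ≤ y → y ≤ ((j : ℝ) + 1) / 2 → distInt y = c + s * y := by
  obtain ⟨i, rfl | rfl⟩ := Int.even_or_odd' j
  · refine ⟨-i, 1, fun y h0 h1 => ?_⟩
    push_cast at h0 h1
    rw [← distInt_add_int y (-i), distInt_eq_self] <;> push_cast <;> linarith
  · refine ⟨i + 1, -1, fun y h0 h1 => ?_⟩
    push_cast at h0 h1
    rw [← distInt_add_int y (-i), distInt_eq_one_sub] <;> push_cast <;> linarith

theorem neg_one_zpow_sq (q : ℤ) : ((-1 : ℝ) ^ q) ^ 2 = 1 := by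
  rcases Int.even_or_odd q with h | h
  · simp [h.neg_one_zpow]
  · simp [h.neg_one_zpow]

theorem abs_neg_one_zpow_eq_one (q : ℤ) : |(-1 : ℝ) ^ q| = 1 := by
  rcases Int.even_or_odd q with h | h
  · simp [h.neg_one_zpow]
  · simp [h.neg_one_zpow]

/-- The distance to `ℤ` of `c q / 2` depends only on the parity of `q`. -/
theorem distInt_nat_mul_half (c : ℕ) (q : ℤ) :
    distInt (c * (q / 2)) = (1 - (-1 : ℝ) ^ q) / 2 * distInt (c / 2) := by
  obtain ⟨i, rfl | rfl⟩ := Int.even_or_odd' q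
  · have h : Even (2 * i) := even_two_mul i
    rw [h.neg_one_zpow]
    have e : (c : ℝ) * (((2 * i : ℤ) : ℝ) / 2) = ((c * i : ℤ) : ℝ) := by push_cast; ring
    rw [e, distInt_intCast]
    ring
  · have h : Odd (2 * i + 1) := odd_two_mul_add_one i
    rw [h.neg_one_zpow]
    have e : (c : ℝ) * (((2 * i + 1 : ℤ) : ℝ) / 2) = c / 2 + ((c * i : ℤ) : ℝ) := by
      push_cast; ring
    rw [e, distInt_add_int]
    ring

/-! ### The series and its values on the half-integer grids -/

/-- The series `∑ b_k d(r^k x) / r^k`. -/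
noncomputable def adicSeries (r : ℕ) (b : ℕ → ℝ) (x : ℝ) : ℝ :=
  ∑' k : ℕ, b k * (distInt ((r : ℝ) ^ k * x) / (r : ℝ) ^ k)

theorem takagiVdW_eq_adicSeries (r : ℕ) (a : ℕ → ℝ) :
    takagiVdW r a = adicSeries r fun k => a (k + 1) := by
  funext x
  simp [takagiVdW, adicSeries, takagiPsi]

section
variable {r : ℕ} {b : ℕ → ℝ}

theorem summable_adicSeries (hb : Summable fun k : ℕ => |b k / (r : ℝ) ^ k|) (x : ℝ) :
    Summable fun k : ℕ => b k * (distInt ((r : ℝ) ^ k * x) / (r : ℝ) ^ k) := by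
  refine Summable.of_norm_bounded hb fun k => ?_
  have h : |distInt ((r : ℝ) ^ k * x)| ≤ 1 := by
    rw [abs_of_nonneg (distInt_nonneg _)]
    exact (distInt_le_half _).trans (by norm_num)
  have e : b k * (distInt ((r : ℝ) ^ k * x) / (r : ℝ) ^ k)
      = b k / (r : ℝ) ^ k * distInt ((r : ℝ) ^ k * x) := by ring
  rw [e, Real.norm_eq_abs, abs_mul]
  exact mul_le_of_le_one_right (abs_nonneg _) h

theorem continuous_adicSeries (hb : Summable fun k : ℕ => |b k / (r : ℝ) ^ k|) :
    Continuous (adicSeries r b) := by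
  refine continuous_tsum (fun k => ?_) hb fun k x => ?_
  · exact continuous_const.mul
      ((continuous_distInt.comp (continuous_const.mul continuous_id)).div_const _)
  · have h : |distInt ((r : ℝ) ^ k * x)| ≤ 1 := by
      rw [abs_of_nonneg (distInt_nonneg _)]
      exact (distInt_le_half _).trans (by norm_num)
    have e : b k * (distInt ((r : ℝ) ^ k * x) / (r : ℝ) ^ k)
        = b k / (r : ℝ) ^ k * distInt ((r : ℝ) ^ k * x) := by ring
    rw [e, Real.norm_eq_abs, abs_mul]
    exact mul_le_of_le_one_right (abs_nonneg _) h

/-- The weighted tail `∑_l b_{n+l} (2 d(r^l / 2)) / r^l`, which governs the oscillation of the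
series on the grid of step `1 / (2 r^n)`. -/
noncomputable def adicTail (r : ℕ) (b : ℕ → ℝ) (n : ℕ) : ℝ :=
  ∑' l : ℕ, b (n + l) * (2 * distInt (((r ^ l : ℕ) : ℝ) / 2)) / (r : ℝ) ^ l

/-- The difference quotient over the `q`-th cell of the grid of step `1 / (2 r^n)`. -/
noncomputable def cellSlope (r : ℕ) (b : ℕ → ℝ) (n : ℕ) (q : ℤ) : ℝ :=
  2 * (r : ℝ) ^ n * (adicSeries r b (((q : ℝ) + 1) / (2 * (r : ℝ) ^ n))
    - adicSeries r b ((q : ℝ) / (2 * (r : ℝ) ^ n)))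

theorem summable_adicTail (hr : 2 ≤ r) (hb : Summable fun k : ℕ => |b k / (r : ℝ) ^ k|) (n : ℕ) :
    Summable fun l : ℕ => b (n + l) * (2 * distInt (((r ^ l : ℕ) : ℝ) / 2)) / (r : ℝ) ^ l := by
  have hr0 : (0 : ℝ) < r := by positivity
  have h1 := ((summable_nat_add_iff n).2 hb).mul_left ((r : ℝ) ^ n)
  refine Summable.of_norm_bounded h1 fun l => ?_
  have h : |2 * distInt (((r ^ l : ℕ) : ℝ) / 2)| ≤ 1 := by
    rw [abs_of_nonneg (by linarith [distInt_nonneg (((r ^ l : ℕ) : ℝ) / 2)])]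
    linarith [distInt_le_half (((r ^ l : ℕ) : ℝ) / 2)]
  have e : (r : ℝ) ^ n * |b (l + n) / (r : ℝ) ^ (l + n)| = |b (n + l) / (r : ℝ) ^ l| := by
    rw [add_comm l n, pow_add, abs_div, abs_div, abs_of_pos (by positivity : (0:ℝ) < r ^ n * r ^ l),
      abs_of_pos (by positivity : (0:ℝ) < r ^ l)]
    field_simp
  rw [e, mul_div_right_comm, Real.norm_eq_abs, abs_mul]
  exact mul_le_of_le_one_right (abs_nonneg _) h

/-- Since r^(l+n) · q/(2r^n) = r^l q/2, every term vanishes for even q and takes one common value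
for all odd q; the parity factor leaves the sum. -/
theorem tsum_tail_grid (hr : 2 ≤ r) (n : ℕ) (q : ℤ) :
    ∑' l : ℕ, b (l + n) * (distInt ((r : ℝ) ^ (l + n) * ((q : ℝ) / (2 * (r : ℝ) ^ n)))
        / (r : ℝ) ^ (l + n))
      = (1 - (-1 : ℝ) ^ q) / (4 * (r : ℝ) ^ n) * adicTail r b n := by
  have hr0 : (0 : ℝ) < r := by positivity
  rw [adicTail, ← tsum_mul_left]
  refine tsum_congr fun l => ?_
  have e : (r : ℝ) ^ (l + n) * ((q : ℝ) / (2 * (r : ℝ) ^ n)) = ((r ^ l : ℕ) : ℝ) * (q / 2) := by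
    push_cast
    rw [pow_add]
    field_simp
  rw [e, distInt_nat_mul_half, add_comm l n, pow_add]
  field_simp
  ring

theorem adicSeries_half_int (hr : 2 ≤ r) (q : ℤ) :
    adicSeries r b ((q : ℝ) / 2) = (1 - (-1 : ℝ) ^ q) / 4 * adicTail r b 0 := by
  have h := tsum_tail_grid (b := b) hr 0 q
  simpa [adicSeries] using h

theorem cellSlope_zero (hr : 2 ≤ r) (q : ℤ) :
    cellSlope r b 0 q = (-1 : ℝ) ^ q * adicTail r b 0 := by
  have h1 := adicSeries_half_int (b := b) hr q
  have h2 := adicSeries_half_int (b := b) hr (q + 1)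
  rw [zpow_add_one₀ (by norm_num)] at h2
  push_cast at h2
  simp only [cellSlope, pow_zero, mul_one, h1, h2]
  ring

/-- On a cell of the grid of step `1 / (2 r^n)`, at the points of the next grid, the series is an
affine function plus an alternating term. -/
theorem adicSeries_grid (hr : 2 ≤ r) (hb : Summable fun k : ℕ => |b k / (r : ℝ) ^ k|)
    (n : ℕ) (m : ℤ) :
    ∃ c s : ℝ, ∀ q : ℤ, r * m ≤ q → q ≤ r * m + r →
      adicSeries r b ((q : ℝ) / (2 * (r : ℝ) ^ (n + 1)))
        = c + s * q + (1 - (-1 : ℝ) ^ q) / (4 * (r : ℝ) ^ (n + 1)) * adicTail r b (n + 1) := by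
  have hr0 : (0 : ℝ) < r := by positivity
  have key : ∀ k ∈ Finset.range (n + 1), ∃ c s : ℝ, ∀ q : ℤ, r * m ≤ q → q ≤ r * m + r →
      b k * (distInt ((r : ℝ) ^ k * ((q : ℝ) / (2 * (r : ℝ) ^ (n + 1)))) / (r : ℝ) ^ k)
        = c + s * q := by
    intro k hk
    obtain ⟨l, rfl⟩ : ∃ l, n = k + l := ⟨n - k, by have := Finset.mem_range.1 hk; omega⟩
    -- The floor quotient j indexes the ancestor of cell m at level k: r^k x stays in [j/2, (j+1)/2]
    -- as x runs over cell m.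
    obtain ⟨c, s, h⟩ := distInt_affine_on_half (m / (r ^ l : ℕ))
    refine ⟨b k * c / r ^ k, b k * s / r ^ k / (2 * (r : ℝ) ^ (l + 1)), fun q h1 h2 => ?_⟩
    have e : (r : ℝ) ^ k * ((q : ℝ) / (2 * (r : ℝ) ^ (k + l + 1)))
        = q / (2 * (r : ℝ) ^ (l + 1)) := by
      rw [add_assoc, pow_add]
      field_simp
    have hP : (0 : ℤ) < (r ^ l : ℕ) := by positivity
    have hm1 : (m / (r ^ l : ℕ)) * (r ^ l : ℕ) ≤ m := Int.ediv_mul_le _ hP.ne'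
    have hm2 : m + 1 ≤ (m / (r ^ l : ℕ) + 1) * (r ^ l : ℕ) :=
      Int.lt_ediv_add_one_mul_self _ hP
    have hq1 : (r : ℝ) * m ≤ q := by exact_mod_cast h1
    have hq2 : (q : ℝ) ≤ r * (m + 1) := by
      have : (q : ℝ) ≤ r * m + r := by exact_mod_cast h2
      linarith
    generalize m / ((r ^ l : ℕ) : ℤ) = j at *
    have hm1' : (j : ℝ) * (r : ℝ) ^ l ≤ m := by exact_mod_cast hm1
    have hm2' : (m : ℝ) + 1 ≤ (j + 1) * (r : ℝ) ^ l := by exact_mod_cast hm2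
    rw [e, h]
    · ring
    · rw [div_le_div_iff₀ (by norm_num) (by positivity), pow_succ]
      nlinarith [mul_le_mul_of_nonneg_left hm1' hr0.le]
    · rw [div_le_div_iff₀ (by positivity) (by norm_num), pow_succ]
      nlinarith [mul_le_mul_of_nonneg_left hm2' hr0.le]
  choose! c s h using key
  refine ⟨∑ k ∈ Finset.range (n + 1), c k, ∑ k ∈ Finset.range (n + 1), s k, fun q h1 h2 => ?_⟩
  rw [adicSeries, ← (summable_adicSeries hb _).sum_add_tsum_nat_add (n + 1), tsum_tail_grid hr,
    Finset.sum_mul, ← Finset.sum_add_distrib]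
  congr 1
  exact Finset.sum_congr rfl fun k hk => h k hk q h1 h2

/-- The affine part has the same slope s on all siblings, and the alternating term jumps between 0
and R/(2r^(n+1)) from one grid point to the next. -/
theorem cellSlope_succ (hr : 2 ≤ r) (hb : Summable fun k : ℕ => |b k / (r : ℝ) ^ k|)
    (n : ℕ) (m : ℤ) :
    ∃ s : ℝ, ∀ i : ℕ, i < r → cellSlope r b (n + 1) (r * m + i)
        = s + (-1 : ℝ) ^ (r * m + i : ℤ) * adicTail r b (n + 1) := by
  have hr0 : (0 : ℝ) < r := by positivity
  obtain ⟨c, s, h⟩ := adicSeries_grid hr hb n m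
  refine ⟨2 * (r : ℝ) ^ (n + 1) * s, fun i hi => ?_⟩
  have h1 := h (r * m + i) (by omega) (by omega)
  have h2 := h (r * m + i + 1) (by omega) (by omega)
  rw [zpow_add_one₀ (by norm_num)] at h2
  have e : (((r * m + i + 1 : ℤ)) : ℝ) = ((r * m + i : ℤ) : ℝ) + 1 := by push_cast; ring
  rw [e] at h2
  rw [cellSlope, h1, h2]
  field_simp
  ring

/-- The martingale property: the increments over the children telescope. -/
theorem sum_cellSlope_succ (hr : 2 ≤ r) (n : ℕ) (m : ℤ) :
    ∑ i ∈ Finset.range r, cellSlope r b (n + 1) (r * m + i) = r * cellSlope r b n m := by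
  have hr0 : (0 : ℝ) < r := by positivity
  have h : ∀ i : ℕ, cellSlope r b (n + 1) (r * m + i) = 2 * (r : ℝ) ^ (n + 1) *
      (adicSeries r b ((r * m + (i + 1 : ℕ)) / (2 * (r : ℝ) ^ (n + 1)))
        - adicSeries r b ((r * m + i) / (2 * (r : ℝ) ^ (n + 1)))) := by
    intro i
    rw [cellSlope]
    push_cast
    rw [← add_assoc]
  simp_rw [h]
  rw [← Finset.mul_sum, Finset.sum_range_sub
    (fun i : ℕ => adicSeries r b ((r * m + i) / (2 * (r : ℝ) ^ (n + 1))))]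
  have e1 : ((r : ℝ) * m + r) / (2 * (r : ℝ) ^ (n + 1)) = (m + 1) / (2 * (r : ℝ) ^ n) := by
    rw [pow_succ]
    field_simp
  have e2 : ((r : ℝ) * m + (0 : ℕ)) / (2 * (r : ℝ) ^ (n + 1)) = m / (2 * (r : ℝ) ^ n) := by
    rw [pow_succ]
    push_cast
    field_simp
    ring
  rw [e1, e2, cellSlope, pow_succ]
  ring

theorem abs_sum_neg_one_zpow_le (r : ℕ) (m : ℤ) :
    |∑ i ∈ Finset.range r, (-1 : ℝ) ^ (m + i : ℤ)| ≤ 1 := by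
  have h : ∀ i : ℕ, (-1 : ℝ) ^ (m + i : ℤ) = (-1 : ℝ) ^ m * (-1 : ℝ) ^ i := fun i => by
    rw [zpow_add₀ (by norm_num), zpow_natCast]
  simp_rw [h]
  rw [← Finset.mul_sum, abs_mul, abs_neg_one_zpow_eq_one, neg_one_geom_sum]
  split_ifs <;> simp

/-- The conditional second moment of the next cell slopes, given the current one. -/
theorem sum_cellSlope_succ_sq (hr : 2 ≤ r) (hb : Summable fun k : ℕ => |b k / (r : ℝ) ^ k|)
    (n : ℕ) (m : ℤ) :
    r * (cellSlope r b n m ^ 2 + 3 / 4 * adicTail r b (n + 1) ^ 2)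
        ≤ ∑ i ∈ Finset.range r, cellSlope r b (n + 1) (r * m + i) ^ 2 ∧
      ∑ i ∈ Finset.range r, cellSlope r b (n + 1) (r * m + i) ^ 2
        ≤ r * (cellSlope r b n m ^ 2 + adicTail r b (n + 1) ^ 2) := by
  have hr0 : (0 : ℝ) < r := by positivity
  have hr2 : (2 : ℝ) ≤ r := by exact_mod_cast hr
  obtain ⟨s, h⟩ := cellSlope_succ hr hb n m
  have hs := sum_cellSlope_succ (b := b) hr n m
  have hσ := abs_sum_neg_one_zpow_le r (r * m)
  set σ := ∑ i ∈ Finset.range r, (-1 : ℝ) ^ (r * m + i : ℤ) with hσd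
  set R := adicTail r b (n + 1)
  have e1 : ∑ i ∈ Finset.range r, cellSlope r b (n + 1) (r * m + i) = r * s + σ * R := by
    rw [Finset.sum_congr rfl fun i hi => h i (Finset.mem_range.1 hi), Finset.sum_add_distrib,
      hσd, Finset.sum_mul]
    simp
  have e2 : ∑ i ∈ Finset.range r, cellSlope r b (n + 1) (r * m + i) ^ 2
      = r * s ^ 2 + 2 * s * σ * R + r * R ^ 2 := by
    have : ∀ i ∈ Finset.range r, cellSlope r b (n + 1) (r * m + i) ^ 2
        = (s ^ 2 + R ^ 2) + 2 * s * R * (-1 : ℝ) ^ (r * m + i : ℤ) := fun i hi => by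
      rw [h i (Finset.mem_range.1 hi)]
      linear_combination R ^ 2 * neg_one_zpow_sq (r * m + i)
    rw [Finset.sum_congr rfl this, Finset.sum_add_distrib, ← Finset.mul_sum, ← hσd]
    simp
    ring
  have e3 : cellSlope r b n m = s + σ * R / r := by
    rw [hs] at e1
    field_simp
    linarith
  have hσ2 : σ ^ 2 ≤ 1 := by rw [← sq_abs]; exact pow_le_one₀ (abs_nonneg _) hσ
  have e4 : r * cellSlope r b n m ^ 2 = r * s ^ 2 + 2 * s * σ * R + σ ^ 2 * R ^ 2 / r := by
    rw [e3]
    field_simp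
    ring
  rw [mul_add, mul_add, e4, e2]
  -- The conditional variance is R²(1 - σ²/r²); |σ| ≤ 1 and r ≥ 2 give the constant 3/4.
  have h5 : σ ^ 2 * R ^ 2 / r ≤ r * (1 / 4 * R ^ 2) := by
    rw [div_le_iff₀ hr0]
    nlinarith [mul_le_mul_of_nonneg_right hσ2 (sq_nonneg R), sq_nonneg R,
      mul_le_mul_of_nonneg_right (by nlinarith : (4 : ℝ) ≤ r * r) (sq_nonneg R)]
  have h6 : 0 ≤ σ ^ 2 * R ^ 2 / r := by positivity
  constructor <;> nlinarith

/-- The parent slope is s + (σ/r)R with |σ/r| ≤ 1 and a child's is s ± R. This bounds the overshoot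
at the stopping time. -/
theorem abs_cellSlope_succ_sub_le (hr : 2 ≤ r) (hb : Summable fun k : ℕ => |b k / (r : ℝ) ^ k|)
    (n : ℕ) (m : ℤ) (i : ℕ) (hi : i < r) :
    |cellSlope r b (n + 1) (r * m + i) - cellSlope r b n m| ≤ 2 * |adicTail r b (n + 1)| := by
  have hr0 : (0 : ℝ) < r := by positivity
  have hr1 : (1 : ℝ) ≤ r := by exact_mod_cast (by omega : 1 ≤ r)
  obtain ⟨s, h⟩ := cellSlope_succ hr hb n m
  have hs := sum_cellSlope_succ (b := b) hr n m
  have hσ := abs_sum_neg_one_zpow_le r (r * m)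
  set σ := ∑ i ∈ Finset.range r, (-1 : ℝ) ^ (r * m + i : ℤ) with hσd
  set R := adicTail r b (n + 1)
  have e1 : ∑ i ∈ Finset.range r, cellSlope r b (n + 1) (r * m + i) = r * s + σ * R := by
    rw [Finset.sum_congr rfl fun i hi => h i (Finset.mem_range.1 hi), Finset.sum_add_distrib,
      hσd, Finset.sum_mul]
    simp
  have e3 : cellSlope r b n m = s + σ / r * R := by
    rw [hs] at e1
    field_simp
    linarith
  rw [h i hi, e3]
  have e5 : s + (-1 : ℝ) ^ (r * m + i : ℤ) * R - (s + σ / r * R)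
      = ((-1 : ℝ) ^ (r * m + i : ℤ) - σ / r) * R := by ring
  rw [e5, abs_mul]
  refine mul_le_mul_of_nonneg_right ?_ (abs_nonneg _)
  refine (abs_sub _ _).trans ?_
  rw [abs_neg_one_zpow_eq_one, abs_div, abs_of_pos hr0]
  have : |σ| / r ≤ 1 := by rw [div_le_one hr0]; linarith
  linarith

/-- `b n` is recovered from two consecutive tails. -/
theorem exists_adicTail_recurrence (hr : 2 ≤ r) (hb : Summable fun k : ℕ => |b k / (r : ℝ) ^ k|) (n : ℕ) :
    ∃ e : ℝ, 0 ≤ e ∧ e ≤ 1 / 2 ∧ adicTail r b n = b n + e * adicTail r b (n + 1) := by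
  have hr0 : (0 : ℝ) < r := by positivity
  have hr2 : (2 : ℝ) ≤ r := by exact_mod_cast hr
  have hd0 := distInt_nonneg ((r : ℝ) / 2)
  have hd1 := distInt_le_half ((r : ℝ) / 2)
  have half : distInt (1 / 2) = 1 / 2 := distInt_eq_self (by norm_num) le_rfl
  -- This e is 1/r for odd r and 0 for even r.
  refine ⟨2 * distInt ((r : ℝ) / 2) / r, by positivity, ?_, ?_⟩
  · rw [div_le_iff₀ hr0]
    linarith
  have h := (summable_adicTail hr hb n).sum_add_tsum_nat_add 1
  rw [adicTail, ← h, Finset.sum_range_one, adicTail, ← tsum_mul_left]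
  congr 1
  · rw [one_div] at half
    simp [half]
  · refine tsum_congr fun l => ?_
    rw [add_comm l 1, ← add_assoc, pow_add, pow_add]
    -- For natural c the weight 2 d(c/2) is the indicator of odd c, hence multiplicative.
    have e : distInt (((r ^ 1 * r ^ l : ℕ) : ℝ) / 2)
        = 2 * distInt ((r : ℝ) / 2) * distInt (((r ^ l : ℕ) : ℝ) / 2) := by
      have h1 := distInt_nat_mul_half r ((r ^ l : ℕ) : ℤ)
      have h2 := distInt_nat_mul_half 1 ((r ^ l : ℕ) : ℤ)
      simp only [Nat.cast_one, one_mul, half, Int.cast_natCast] at h1 h2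
      rw [h2, show (((r ^ 1 * r ^ l : ℕ) : ℝ) / 2) = r * (((r ^ l : ℕ) : ℝ) / 2) by
        push_cast; ring, h1]
      ring
    rw [e]
    field_simp

end

section
variable {r : ℕ} {b : ℕ → ℝ}

/-! ### Differentiability forces the coefficients to tend to zero -/

theorem tendsto_inv_two_mul_pow (hr : 2 ≤ r) :
    Tendsto (fun n : ℕ => (2 * (r : ℝ) ^ n)⁻¹) atTop (𝓝 0) := by
  have hr1 : (1 : ℝ) < r := by exact_mod_cast hr
  exact tendsto_inv_atTop_zero.comp
    ((tendsto_pow_atTop_atTop_of_one_lt hr1).const_mul_atTop (by norm_num))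

/-- Slopes over cells that stay within boundedly many cells of a point of differentiability
converge to the derivative. -/
theorem tendsto_cellSlope_of_hasDerivAt (hr : 2 ≤ r) {x L C : ℝ}
    (hL : HasDerivAt (adicSeries r b) L x) (q : ℕ → ℤ)
    (hq : ∀ n, |(q n : ℝ) - 2 * (r : ℝ) ^ n * x| ≤ C) :
    Tendsto (fun n => cellSlope r b n (q n)) atTop (𝓝 L) := by
  have hr0 : (0 : ℝ) < r := by positivity
  have hC : 0 ≤ C := (abs_nonneg _).trans (hq 0)
  rw [Metric.tendsto_atTop]
  intro ε hε
  -- The endpoints lie within C and C + 1 steps of x, so the slope error is at most η(2C + 1) < ε.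
  set η := ε / (2 * C + 2) with hη
  have hη0 : 0 < η := by positivity
  have hlo := hL.isLittleO.def hη0
  rw [Metric.eventually_nhds_iff] at hlo
  obtain ⟨δ, hδ, hlo⟩ := hlo
  have ht := (tendsto_inv_two_mul_pow hr).const_mul (C + 1)
  rw [mul_zero] at ht
  obtain ⟨n0, hn0⟩ := (ht.eventually (gt_mem_nhds hδ)).exists_forall_of_atTop
  refine ⟨n0, fun n hn => ?_⟩
  have hc : (0 : ℝ) < 2 * (r : ℝ) ^ n := by positivity
  have hsmall := hn0 n hn
  set c := 2 * (r : ℝ) ^ n with hcd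
  have hu : |(q n : ℝ) / c - x| ≤ C * c⁻¹ := by
    have : (q n : ℝ) / c - x = (q n - c * x) * c⁻¹ := by field_simp
    rw [this, abs_mul, abs_of_pos (inv_pos.2 hc)]
    exact mul_le_mul_of_nonneg_right (hq n) (inv_pos.2 hc).le
  have hv : |((q n : ℝ) + 1) / c - x| ≤ (C + 1) * c⁻¹ := by
    have : ((q n : ℝ) + 1) / c - x = ((q n : ℝ) / c - x) + c⁻¹ := by field_simp; ring
    rw [this]
    refine (abs_add_le _ _).trans ?_
    rw [abs_of_pos (inv_pos.2 hc)]
    linarith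
  have hci := inv_pos.2 hc
  have e1 := hlo (y := (q n : ℝ) / c) (by rw [Real.dist_eq]; linarith)
  have e2 := hlo (y := ((q n : ℝ) + 1) / c) (by rw [Real.dist_eq]; linarith)
  simp only [Real.norm_eq_abs, smul_eq_mul] at e1 e2
  have e3 : cellSlope r b n (q n) - L
      = c * ((adicSeries r b (((q n : ℝ) + 1) / c) - adicSeries r b x
          - (((q n : ℝ) + 1) / c - x) * L)
        - (adicSeries r b ((q n : ℝ) / c) - adicSeries r b x - ((q n : ℝ) / c - x) * L)) := by
    rw [cellSlope]
    field_simp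
    ring
  rw [Real.dist_eq, e3, abs_mul, abs_of_pos hc]
  have e4 := abs_sub (adicSeries r b (((q n : ℝ) + 1) / c) - adicSeries r b x
          - (((q n : ℝ) + 1) / c - x) * L)
          (adicSeries r b ((q n : ℝ) / c) - adicSeries r b x - ((q n : ℝ) / c - x) * L)
  have e5 : c * |(adicSeries r b (((q n : ℝ) + 1) / c) - adicSeries r b x
          - (((q n : ℝ) + 1) / c - x) * L)
        - (adicSeries r b ((q n : ℝ) / c) - adicSeries r b x - ((q n : ℝ) / c - x) * L)|
      ≤ c * (η * ((C + 1) * c⁻¹) + η * (C * c⁻¹)) := by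
    refine mul_le_mul_of_nonneg_left ?_ hc.le
    have := mul_le_mul_of_nonneg_left hu hη0.le
    have := mul_le_mul_of_nonneg_left hv hη0.le
    linarith
  refine e5.trans_lt ?_
  have e6 : c * (η * ((C + 1) * c⁻¹) + η * (C * c⁻¹)) = η * (2 * C + 1) := by
    field_simp
    ring
  rw [e6, hη, div_mul_eq_mul_div, div_lt_iff₀ (by positivity)]
  nlinarith

theorem abs_floor_sub_le_one (y : ℝ) : |(⌊y⌋ : ℝ) - y| ≤ 1 := by
  have h1 := Int.floor_le y
  have h2 := Int.lt_floor_add_one y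
  rw [abs_le]
  constructor <;> linarith

theorem tendsto_zero_of_differentiableAt (hr : 2 ≤ r)
    (hb : Summable fun k : ℕ => |b k / (r : ℝ) ^ k|) {x : ℝ}
    (hx : DifferentiableAt ℝ (adicSeries r b) x) : Tendsto b atTop (𝓝 0) := by
  have hr0 : (0 : ℝ) < r := by positivity
  have hr1 : (1 : ℝ) ≤ r := by exact_mod_cast (by omega : 1 ≤ r)
  have key : ∀ i : ℕ, i < 2 → Tendsto
      (fun n => cellSlope r b (n + 1) (r * ⌊2 * (r : ℝ) ^ n * x⌋ + i)) atTop
      (𝓝 (deriv (adicSeries r b) x)) := by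
    intro i hi
    -- The sequence is shifted by one; its dummy value 0 at n = 0 costs the |2x| in C and is dropped
    -- afterwards.
    have h := tendsto_cellSlope_of_hasDerivAt hr (C := 2 * r + 1 + |2 * x|) hx.hasDerivAt
      (fun n => if n = 0 then 0 else r * ⌊2 * (r : ℝ) ^ (n - 1) * x⌋ + i) (fun n => ?_)
    · have h2 := (tendsto_add_atTop_iff_nat 1).2 h
      simpa using h2
    · rcases n with _ | n
      · simp
        nlinarith
      · simp only [Nat.add_eq_zero_iff, one_ne_zero, and_false, if_false, Nat.add_sub_cancel]
        have e : (((r * ⌊2 * (r : ℝ) ^ n * x⌋ + i : ℤ)) : ℝ) - 2 * (r : ℝ) ^ (n + 1) * x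
            = r * ((⌊2 * (r : ℝ) ^ n * x⌋ : ℝ) - 2 * (r : ℝ) ^ n * x) + i := by
          push_cast
          ring
        rw [e]
        refine (abs_add_le _ _).trans ?_
        rw [abs_mul, abs_of_pos hr0]
        have h1 := mul_le_mul_of_nonneg_left (abs_floor_sub_le_one (2 * (r : ℝ) ^ n * x)) hr0.le
        have h2 : |(i : ℝ)| ≤ 1 := by
          rw [abs_of_nonneg (Nat.cast_nonneg i)]
          exact_mod_cast (by omega : i ≤ 1)
        have := abs_nonneg (2 * x)
        linarith
  have hR : Tendsto (fun n => adicTail r b (n + 1)) atTop (𝓝 0) := by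
    have h := ((key 0 (by norm_num)).sub (key 1 (by norm_num))).abs
    rw [sub_self, abs_zero] at h
    refine squeeze_zero_norm (fun n => ?_) h
    obtain ⟨s, hs⟩ := cellSlope_succ hr hb n ⌊2 * (r : ℝ) ^ n * x⌋
    rw [hs 0 (by omega), hs 1 (by omega)]
    generalize (r * ⌊2 * (r : ℝ) ^ n * x⌋ : ℤ) = m
    push_cast
    rw [add_zero, zpow_add_one₀ (by norm_num), show s + (-1 : ℝ) ^ m * adicTail r b (n + 1)
      - (s + (-1 : ℝ) ^ m * -1 * adicTail r b (n + 1))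
        = (-1 : ℝ) ^ m * (2 * adicTail r b (n + 1)) by ring, abs_mul, abs_neg_one_zpow_eq_one, one_mul,
      abs_mul, Real.norm_eq_abs, abs_two]
    linarith [abs_nonneg (adicTail r b (n + 1))]
  have hR0 : Tendsto (adicTail r b) atTop (𝓝 0) := (tendsto_add_atTop_iff_nat 1).1 hR
  have hsum := hR0.abs.add hR.abs
  rw [abs_zero, add_zero] at hsum
  refine squeeze_zero_norm (fun n => ?_) hsum
  obtain ⟨e, he0, he1, he⟩ := exists_adicTail_recurrence hr hb n
  have : b n = adicTail r b n - e * adicTail r b (n + 1) := by linarith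
  rw [Real.norm_eq_abs, this]
  refine (abs_sub _ _).trans ?_
  rw [abs_mul, abs_of_nonneg he0]
  nlinarith [abs_nonneg (adicTail r b (n + 1))]

/-! ### Energy on the grids and absolute continuity -/

theorem abs_adicTail_le (hr : 2 ≤ r) {B : ℝ} (hB : ∀ k, |b k| ≤ B) (n : ℕ) :
    |adicTail r b n| ≤ 2 * B := by
  have hr0 : (0 : ℝ) < r := by positivity
  have hr2 : (2 : ℝ) ≤ r := by exact_mod_cast hr
  rw [mul_comm, ← Real.norm_eq_abs]
  refine tsum_of_norm_bounded (hasSum_geometric_two.mul_left B) fun l => ?_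
  have h : |2 * distInt (((r ^ l : ℕ) : ℝ) / 2)| ≤ 1 := by
    rw [abs_of_nonneg (by linarith [distInt_nonneg (((r ^ l : ℕ) : ℝ) / 2)])]
    linarith [distInt_le_half (((r ^ l : ℕ) : ℝ) / 2)]
  have hB0 : 0 ≤ B := (abs_nonneg _).trans (hB 0)
  rw [Real.norm_eq_abs, abs_div, abs_mul, abs_of_pos (by positivity : (0 : ℝ) < r ^ l),
    div_eq_mul_inv]
  refine mul_le_mul ?_ ?_ (by positivity) hB0
  · exact (mul_le_of_le_one_right (abs_nonneg _) h).trans (hB _)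
  · rw [one_div, inv_pow]
    exact inv_anti₀ (by positivity) (pow_le_pow_left₀ (by norm_num) hr2 l)

/-- Summing R_j² ≤ 2b_j² + R_{j+1}²/2 lets half of the sum be absorbed on the left; the boundary
term R_n² is at most 4S, whence 8S. -/
theorem exists_sum_adicTail_sq_le (hr : 2 ≤ r) (hb : Summable fun k : ℕ => |b k / (r : ℝ) ^ k|)
    (h2 : Summable fun k => b k ^ 2) :
    ∃ E : ℝ, 0 ≤ E ∧ ∀ n, ∑ j ∈ Finset.range n, adicTail r b j ^ 2 ≤ E := by
  have hS : ∀ k, b k ^ 2 ≤ ∑' k, b k ^ 2 := fun k =>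
    h2.le_tsum k fun j _ => sq_nonneg _
  have hS0 : 0 ≤ ∑' k, b k ^ 2 := tsum_nonneg fun k => sq_nonneg _
  set S := ∑' k, b k ^ 2
  have hB : ∀ k, |b k| ≤ √S := fun k => Real.abs_le_sqrt (hS k)
  have hR := fun n => abs_adicTail_le hr hB n
  have hR2 : ∀ n, adicTail r b n ^ 2 ≤ 4 * S := fun n => by
    rw [← sq_abs]
    calc _ ≤ (2 * √S) ^ 2 := pow_le_pow_left₀ (abs_nonneg _) (hR n) 2
      _ = 4 * S := by rw [mul_pow, Real.sq_sqrt hS0]; norm_num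
  refine ⟨8 * S, by positivity, fun n => ?_⟩
  have step : ∀ j, adicTail r b j ^ 2 ≤ 2 * b j ^ 2 + 1 / 2 * adicTail r b (j + 1) ^ 2 := fun j => by
    obtain ⟨e, he0, he1, he⟩ := exists_adicTail_recurrence hr hb j
    rw [he]
    have : e ^ 2 ≤ 1 / 4 := by nlinarith
    nlinarith [sq_nonneg (b j - e * adicTail r b (j + 1)),
      mul_le_mul_of_nonneg_right this (sq_nonneg (adicTail r b (j + 1)))]
  have h1 := Finset.sum_le_sum fun j (_ : j ∈ Finset.range n) => step j
  rw [Finset.sum_add_distrib, ← Finset.mul_sum, ← Finset.mul_sum] at h1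
  have h3 : ∑ j ∈ Finset.range n, b j ^ 2 ≤ S := h2.sum_le_tsum _ fun j _ => sq_nonneg _
  have h4 := Finset.sum_range_succ (fun j => adicTail r b j ^ 2) n
  have h5 := Finset.sum_range_succ' (fun j => adicTail r b j ^ 2) n
  have h6 := hR2 n
  have h7 := sq_nonneg (adicTail r b 0)
  linarith

theorem sum_Ico_mul_int {r : ℕ} (hr : 0 < r) (A B : ℤ) (F : ℤ → ℝ) :
    ∑ q ∈ Finset.Ico (r * A) (r * B), F q
      = ∑ m ∈ Finset.Ico A B, ∑ i ∈ Finset.range r, F (r * m + i) := by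
  have hr' : (0 : ℤ) < r := by exact_mod_cast hr
  rw [← Finset.sum_product']
  symm
  refine Finset.sum_nbij' (fun p => r * p.1 + p.2) (fun q => (q / r, (q % r).toNat)) ?_ ?_ ?_ ?_ ?_
  · rintro ⟨m, i⟩ h
    simp only [Finset.mem_product, Finset.mem_Ico, Finset.mem_range] at h ⊢
    constructor
    · nlinarith
    · have : (i : ℤ) < r := by exact_mod_cast h.2
      nlinarith
  · intro q h
    simp only [Finset.mem_product, Finset.mem_Ico, Finset.mem_range] at h ⊢
    refine ⟨⟨?_, ?_⟩, ?_⟩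
    · rw [Int.le_ediv_iff_mul_le hr']
      linarith
    · rw [Int.ediv_lt_iff_lt_mul hr']
      linarith
    · have := Int.emod_lt_of_pos q hr'
      have := Int.emod_nonneg q hr'.ne'
      omega
  · rintro ⟨m, i⟩ h
    simp only [Finset.mem_product, Finset.mem_Ico, Finset.mem_range] at h
    have hi : (i : ℤ) < r := by exact_mod_cast h.2
    have e1 : (r * m + i : ℤ) / r = m := by
      rw [Int.add_comm, Int.add_mul_ediv_left _ _ hr'.ne', Int.ediv_eq_zero_of_lt (by omega) hi,
        zero_add]
    have e2 : (r * m + i : ℤ) % r = i := by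
      rw [Int.add_comm, Int.add_mul_emod_self_left, Int.emod_eq_of_lt (by omega) hi]
    simp [e1, e2]
  · intro q h
    have := Int.emod_nonneg q hr'.ne'
    have := Int.mul_ediv_add_emod q r
    simp only
    omega
  · intros
    rfl

theorem sum_Ico_pow_succ (hr : 0 < r) (n A : ℕ) (F : ℤ → ℝ) :
    ∑ q ∈ Finset.Ico (-(r ^ (n + 1) * A : ℤ)) (r ^ (n + 1) * A), F q
      = ∑ m ∈ Finset.Ico (-(r ^ n * A : ℤ)) (r ^ n * A), ∑ i ∈ Finset.range r, F (r * m + i) := by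
  rw [← sum_Ico_mul_int hr]
  congr 2 <;> ring

theorem card_Ico_pow (r n A : ℕ) :
    ((Finset.Ico (-(r ^ n * A : ℤ)) (r ^ n * A)).card : ℝ) = 2 * (r : ℝ) ^ n * A := by
  rw [Int.card_Ico]
  have : (r ^ n * A : ℤ) - -(r ^ n * A) = ((2 * r ^ n * A : ℕ) : ℤ) := by push_cast; ring
  rw [this, Int.toNat_natCast]
  push_cast
  ring

/-- Orthogonality of martingale increments, on the 2r^n A cells of the window [-A/2, A/2). -/
theorem sum_cellSlope_sq_le (hr : 2 ≤ r) (hb : Summable fun k : ℕ => |b k / (r : ℝ) ^ k|)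
    (n A : ℕ) :
    ∑ q ∈ Finset.Ico (-(r ^ n * A : ℤ)) (r ^ n * A), cellSlope r b n q ^ 2
      ≤ 2 * (r : ℝ) ^ n * A * ∑ j ∈ Finset.range (n + 1), adicTail r b j ^ 2 := by
  induction n with
  | zero =>
    simp_rw [cellSlope_zero hr, mul_pow, neg_one_zpow_sq]
    rw [Finset.sum_const, nsmul_eq_mul, card_Ico_pow]
    simp
  | succ n ih =>
    rw [sum_Ico_pow_succ (by omega), Finset.sum_range_succ]
    refine (Finset.sum_le_sum fun m _ => (sum_cellSlope_succ_sq hr hb n m).2).trans ?_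
    rw [← Finset.mul_sum, Finset.sum_add_distrib, Finset.sum_const, nsmul_eq_mul, card_Ico_pow]
    have hr0 : (0 : ℝ) ≤ r := by positivity
    have := mul_le_mul_of_nonneg_left ih hr0
    rw [pow_succ (r : ℝ) n]
    linarith

theorem sum_Ico_cellSlope (hr : 2 ≤ r) (n : ℕ) {i j : ℤ} (hij : i ≤ j) :
    adicSeries r b ((j : ℝ) / (2 * (r : ℝ) ^ n)) - adicSeries r b ((i : ℝ) / (2 * (r : ℝ) ^ n))
      = ∑ m ∈ Finset.Ico i j, cellSlope r b n m / (2 * (r : ℝ) ^ n) := by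
  have hr0 : (0 : ℝ) < r := by positivity
  induction j, hij using Int.leInduction with
  | base => simp
  | succ j hij ih =>
    rw [← Finset.insert_Ico_right_eq_Ico_add_one hij, Finset.sum_insert (by simp), ← ih, cellSlope]
    push_cast
    field_simp
    ring

theorem tendsto_floor_grid (hr : 2 ≤ r) (x : ℝ) :
    Tendsto (fun n : ℕ => (⌊2 * (r : ℝ) ^ n * x⌋ : ℝ) / (2 * (r : ℝ) ^ n)) atTop (𝓝 x) := by
  have hr0 : (0 : ℝ) < r := by positivity
  rw [tendsto_iff_dist_tendsto_zero]
  refine squeeze_zero (fun _ => dist_nonneg) (fun n => ?_) (tendsto_inv_two_mul_pow hr)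
  have hc : (0 : ℝ) < 2 * (r : ℝ) ^ n := by positivity
  have : (⌊2 * (r : ℝ) ^ n * x⌋ : ℝ) / (2 * (r : ℝ) ^ n) - x
      = (⌊2 * (r : ℝ) ^ n * x⌋ - 2 * (r : ℝ) ^ n * x) * (2 * (r : ℝ) ^ n)⁻¹ := by field_simp
  rw [Real.dist_eq, this, abs_mul, abs_of_pos (inv_pos.2 hc)]
  exact mul_le_of_le_one_left (inv_pos.2 hc).le (abs_floor_sub_le_one _)

/-- An energy bound on all grids controls the total variation over disjoint intervals. -/
theorem sum_abs_sub_le_of_energy (hr : 2 ≤ r) (hb : Summable fun k : ℕ => |b k / (r : ℝ) ^ k|)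
    {E M : ℝ} (hM : 0 < M) (hE : ∀ n, ∑ j ∈ Finset.range n, adicTail r b j ^ 2 ≤ E)
    (A : ℕ) (N : ℕ) (p q : ℕ → ℝ) (hpq : ∀ i < N, p i ≤ q i)
    (hp : ∀ i < N, -(A : ℝ) ≤ 2 * p i) (hq : ∀ i < N, 2 * q i ≤ A)
    (hd : Set.PairwiseDisjoint (Finset.range N : Set ℕ) fun i => Set.Ioc (p i) (q i)) :
    ∑ i ∈ Finset.range N, |adicSeries r b (q i) - adicSeries r b (p i)|
      ≤ A * E / (2 * M) + M / 2 * ∑ i ∈ Finset.range N, (q i - p i) := by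
  have hr0 : (0 : ℝ) < r := by positivity
  have hcont := continuous_adicSeries hb
  have hlim (x : ℝ) : Tendsto (fun n : ℕ => adicSeries r b
      ((⌊2 * (r : ℝ) ^ n * x⌋ : ℝ) / (2 * (r : ℝ) ^ n))) atTop (𝓝 (adicSeries r b x)) :=
    (hcont.tendsto x).comp (tendsto_floor_grid hr x)
  -- The inequality is proved with endpoints rounded down to the grid, and passes to the limit by
  -- continuity.
  refine le_of_tendsto_of_tendsto'
    (tendsto_finsetSum _ fun i _ => ((hlim (q i)).sub (hlim (p i))).abs)
    (tendsto_const_nhds.add ((tendsto_finsetSum _ fun i _ =>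
      (tendsto_floor_grid hr (q i)).sub (tendsto_floor_grid hr (p i))).const_mul _)) fun n => ?_
  have hc : (0 : ℝ) < 2 * (r : ℝ) ^ n := by positivity
  have energy := (sum_cellSlope_sq_le hr hb n A).trans
    (mul_le_mul_of_nonneg_left (hE (n + 1)) (by positivity))
  have hcd : (2 : ℝ) * (r : ℝ) ^ n * A = 2 * (r ^ n * A) := by ring
  set c := 2 * (r : ℝ) ^ n with hcdef
  have hfl : ∀ i < N, ⌊c * p i⌋ ≤ ⌊c * q i⌋ := fun i hi =>
    Int.floor_mono (mul_le_mul_of_nonneg_left (hpq i hi) hc.le)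
  have single : ∀ i ∈ Finset.range N,
      |adicSeries r b ((⌊c * q i⌋ : ℝ) / c) - adicSeries r b ((⌊c * p i⌋ : ℝ) / c)|
        ≤ 1 / (2 * M * c) * ∑ m ∈ Finset.Ico ⌊c * p i⌋ ⌊c * q i⌋, cellSlope r b n m ^ 2
          + M / 2 * ((⌊c * q i⌋ : ℝ) / c - (⌊c * p i⌋ : ℝ) / c) := by
    intro i hi
    have hle := hfl i (Finset.mem_range.1 hi)
    rw [sum_Ico_cellSlope hr n hle]
    refine (Finset.abs_sum_le_sum_abs _ _).trans ?_
    have e : (⌊c * q i⌋ : ℝ) / c - (⌊c * p i⌋ : ℝ) / c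
        = ∑ m ∈ Finset.Ico ⌊c * p i⌋ ⌊c * q i⌋, 1 / c := by
      rw [Finset.sum_const, Int.card_Ico, nsmul_eq_mul]
      have : (((⌊c * q i⌋ - ⌊c * p i⌋).toNat : ℕ) : ℝ) = ⌊c * q i⌋ - ⌊c * p i⌋ := by
        have h : (((⌊c * q i⌋ - ⌊c * p i⌋).toNat : ℕ) : ℤ) = ⌊c * q i⌋ - ⌊c * p i⌋ :=
          Int.toNat_of_nonneg (by omega)
        exact_mod_cast h
      rw [this]
      ring
    rw [e, Finset.mul_sum, Finset.mul_sum, ← Finset.sum_add_distrib]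
    refine Finset.sum_le_sum fun m _ => ?_
    rw [abs_div, abs_of_pos hc]
    -- Young's inequality separates energy from length.
    have h1 : |cellSlope r b n m| ≤ 1 / (2 * M) * cellSlope r b n m ^ 2 + M / 2 := by
      rw [← sq_abs, div_mul_eq_mul_div, div_add_div _ _ (by positivity) (by norm_num),
        le_div_iff₀ (by positivity)]
      nlinarith [sq_nonneg (|cellSlope r b n m| - M)]
    calc |cellSlope r b n m| / c
        ≤ (1 / (2 * M) * cellSlope r b n m ^ 2 + M / 2) / c := by gcongr
      _ = _ := by field_simp
  refine (Finset.sum_le_sum single).trans ?_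
  rw [Finset.sum_add_distrib, ← Finset.mul_sum, ← Finset.mul_sum]
  refine add_le_add_left ?_ _
  have disj : Set.PairwiseDisjoint (Finset.range N : Set ℕ)
      fun i => Finset.Ico ⌊c * p i⌋ ⌊c * q i⌋ := by
    intro i hi j hj hij
    have h := hd hi hj hij
    simp only [Function.onFun] at h ⊢
    rw [Finset.disjoint_left]
    intro m hm hm'
    rw [Finset.mem_Ico, Int.floor_le_iff, Int.lt_iff_add_one_le, Int.le_floor] at hm hm'
    -- A cell counted for two intervals would put its right endpoint in both half-open intervals.
    refine Set.disjoint_left.1 h (?_ : ((m + 1 : ℤ) : ℝ) / c ∈ _) ?_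
    · constructor
      · rw [lt_div_iff₀ hc, mul_comm]
        exact_mod_cast hm.1
      · rw [div_le_iff₀ hc, mul_comm]
        exact hm.2
    · constructor
      · rw [lt_div_iff₀ hc, mul_comm]
        exact_mod_cast hm'.1
      · rw [div_le_iff₀ hc, mul_comm]
        exact hm'.2
  rw [← Finset.sum_biUnion disj]
  have hsub : (Finset.range N).biUnion (fun i => Finset.Ico ⌊c * p i⌋ ⌊c * q i⌋)
      ⊆ Finset.Ico (-(r ^ n * A : ℤ)) (r ^ n * A) := by
    intro m hm
    simp only [Finset.mem_biUnion, Finset.mem_range, Finset.mem_Ico] at hm ⊢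
    obtain ⟨i, hi, h1, h2⟩ := hm
    constructor
    · refine le_trans ?_ h1
      rw [Int.le_floor]
      push_cast
      have := mul_le_mul_of_nonneg_left (hp i hi) (by positivity : (0 : ℝ) ≤ (r : ℝ) ^ n)
      rw [hcdef]
      linarith
    · refine lt_of_lt_of_le h2 ?_
      rw [← Int.cast_le (R := ℝ)]
      refine (Int.floor_le _).trans ?_
      push_cast
      have := mul_le_mul_of_nonneg_left (hq i hi) (by positivity : (0 : ℝ) ≤ (r : ℝ) ^ n)
      rw [hcdef]
      linarith
  have h1 := (Finset.sum_le_sum_of_subset_of_nonneg hsub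
    fun m _ _ => sq_nonneg (cellSlope r b n m)).trans energy
  calc _ ≤ 1 / (2 * M * c) * (c * A * E) := mul_le_mul_of_nonneg_left h1 (by positivity)
    _ = A * E / (2 * M) := by field_simp

theorem absolutelyContinuousOnInterval_adicSeries (hr : 2 ≤ r)
    (hb : Summable fun k : ℕ => |b k / (r : ℝ) ^ k|) (h2 : Summable fun k => b k ^ 2) (u v : ℝ) :
    AbsolutelyContinuousOnInterval (adicSeries r b) u v := by
  obtain ⟨E, hE0, hE⟩ := exists_sum_adicTail_sq_le hr hb h2
  obtain ⟨A, hA⟩ := exists_nat_ge (2 * max |u| |v|)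
  have hu := le_max_left |u| |v|
  have hv := le_max_right |u| |v|
  have hwithin : ∀ w ∈ Set.uIcc u v, |2 * w| ≤ A := by
    intro w hw
    rw [Set.mem_uIcc] at hw
    rw [abs_le]
    have h1 := abs_le.1 (le_refl |u|)
    have h2 := abs_le.1 (le_refl |v|)
    rcases hw with hw | hw <;> constructor <;> linarith
  rw [absolutelyContinuousOnInterval_iff]
  intro ε hε
  -- This M brings the energy term to at most ε/2; the length threshold ε/M then handles the other
  -- half.
  set M := A * E / ε + 1 with hM
  have hM0 : 0 < M := by positivity
  refine ⟨ε / M, by positivity, ?_⟩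
  rintro ⟨N, I⟩ ⟨hI, hd⟩ hlen
  simp only at hI hd hlen ⊢
  have key := sum_abs_sub_le_of_energy hr hb hM0 hE A N
    (fun i => min (I i).1 (I i).2) (fun i => max (I i).1 (I i).2)
    (fun i _ => min_le_max) (fun i hi => ?_) (fun i hi => ?_) hd
  · have e1 : ∀ i, |adicSeries r b (max (I i).1 (I i).2) - adicSeries r b (min (I i).1 (I i).2)|
        = dist (adicSeries r b (I i).1) (adicSeries r b (I i).2) := fun i => by
      rw [Real.dist_eq]
      rcases le_total (I i).1 (I i).2 with h | h
      · rw [max_eq_right h, min_eq_left h, abs_sub_comm]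
      · rw [max_eq_left h, min_eq_right h]
    have e2 : ∀ i, max (I i).1 (I i).2 - min (I i).1 (I i).2 = dist (I i).1 (I i).2 := fun i => by
      rw [max_sub_min_eq_abs', Real.dist_eq]
    simp_rw [e1, e2] at key
    refine key.trans_lt ?_
    have h3 : A * E / (2 * M) ≤ ε / 2 := by
      rw [div_le_div_iff₀ (by positivity) (by norm_num)]
      have : A * E ≤ ε * M := by
        rw [hM, mul_add, mul_div_cancel₀ _ hε.ne']
        linarith
      linarith
    have h4 := mul_lt_mul_of_pos_left hlen (by positivity : 0 < M / 2)
    have h5 : M / 2 * (ε / M) = ε / 2 := by field_simp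
    linarith
  · have h := hI i (Finset.mem_range.2 hi)
    have h1 := abs_le.1 (hwithin _ h.1)
    have h2 := abs_le.1 (hwithin _ h.2)
    rcases min_choice (I i).1 (I i).2 with h | h <;> simp only [h] <;> linarith
  · have h := hI i (Finset.mem_range.2 hi)
    have h1 := abs_le.1 (hwithin _ h.1)
    have h2 := abs_le.1 (hwithin _ h.2)
    rcases max_choice (I i).1 (I i).2 with h | h <;> simp only [h] <;> linarith

theorem ae_differentiableAt_of_absolutelyContinuousOnInterval {f : ℝ → ℝ}
    (hf : ∀ u v : ℝ, AbsolutelyContinuousOnInterval f u v) : ∀ᵐ x : ℝ, DifferentiableAt ℝ f x := by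
  refine LocallyBoundedVariationOn.ae_differentiableAt fun u v _ _ => ?_
  exact (hf u v).boundedVariationOn.mono (Set.inter_subset_right.trans Set.Icc_subset_uIcc)

end

section
variable {r : ℕ} {b : ℕ → ℝ}

/-! ### Almost everywhere non-differentiability -/

/-- The martingale of cell slopes, stopped when it first exceeds `K` in absolute value. -/
noncomputable def stoppedSlope (r : ℕ) (b : ℕ → ℝ) (K : ℝ) : ℕ → ℤ → ℝ
  | 0, q => cellSlope r b 0 q
  | n + 1, q => if |stoppedSlope r b K n (q / r)| ≤ K then cellSlope r b (n + 1) q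
      else stoppedSlope r b K n (q / r)

/-- A frozen value exceeds K in absolute value, so a value within K has not been frozen. -/
theorem stoppedSlope_eq {K : ℝ} : ∀ {n : ℕ} {q : ℤ}, |stoppedSlope r b K n q| ≤ K →
    stoppedSlope r b K n q = cellSlope r b n q
  | 0, _, _ => rfl
  | n + 1, q, h => by
    rw [stoppedSlope] at h ⊢
    split_ifs with h1
    · rfl
    · rw [if_neg h1] at h
      exact absurd h h1

theorem child_ediv {i : ℕ} (hi : i < r) (m : ℤ) : (r * m + i : ℤ) / r = m := by
  have hr' : (0 : ℤ) < r := by omega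
  rw [Int.add_comm, Int.add_mul_ediv_left _ _ hr'.ne', Int.ediv_eq_zero_of_lt (by omega)
    (by exact_mod_cast hi), zero_add]

theorem abs_stoppedSlope_le (hr : 2 ≤ r) (hb : Summable fun k : ℕ => |b k / (r : ℝ) ^ k|)
    {K C : ℝ} (hK : 0 ≤ K) (hC : ∀ n, |adicTail r b n| ≤ C) (n : ℕ) (q : ℤ) :
    |stoppedSlope r b K n q| ≤ K + 2 * C := by
  have hC0 : 0 ≤ C := (abs_nonneg _).trans (hC 0)
  induction n generalizing q with
  | zero =>
    rw [stoppedSlope, cellSlope_zero hr, abs_mul, abs_neg_one_zpow_eq_one, one_mul]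
    linarith [hC 0]
  | succ n ih =>
    rw [stoppedSlope]
    split_ifs with h
    · rw [stoppedSlope_eq h] at h
      have hr' : (0 : ℤ) < r := by omega
      have h0 := Int.emod_nonneg q hr'.ne'
      have h1 := Int.emod_lt_of_pos q hr'
      have h2 := abs_cellSlope_succ_sub_le hr hb n (q / r) (q % r).toNat (by omega)
      have h3 : (r * (q / r) + (q % r).toNat : ℤ) = q := by
        have := Int.mul_ediv_add_emod q r
        omega
      rw [h3] at h2
      have h4 := abs_sub_abs_le_abs_sub (cellSlope r b (n + 1) q) (cellSlope r b n (q / r))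
      linarith [hC (n + 1)]
    · exact ih _

/-- The cells of the grid in `[-A / 2, A / 2)` on which no stopping has occurred. -/
noncomputable def aliveCells (r : ℕ) (b : ℕ → ℝ) (K : ℝ) (A n : ℕ) : Finset ℤ :=
  (Finset.Ico (-(r ^ n * A : ℤ)) (r ^ n * A)).filter fun q => |stoppedSlope r b K n q| ≤ K

theorem card_aliveCells_succ_le (hr : 2 ≤ r) (K : ℝ) (A n : ℕ) :
    ((aliveCells r b K A (n + 1)).card : ℝ) ≤ r * (aliveCells r b K A n).card := by
  rw [aliveCells, aliveCells, Finset.card_filter, Finset.card_filter]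
  push_cast
  rw [sum_Ico_pow_succ (by omega), Finset.mul_sum]
  refine Finset.sum_le_sum fun m _ => ?_
  have h : ∀ i ∈ Finset.range r,
      (if |stoppedSlope r b K (n + 1) (r * m + i)| ≤ K then (1 : ℝ) else 0)
        ≤ if |stoppedSlope r b K n m| ≤ K then 1 else 0 := fun i hi => by
    rw [stoppedSlope, child_ediv (Finset.mem_range.1 hi)]
    by_cases h1 : |stoppedSlope r b K n m| ≤ K
    · rw [if_pos h1, if_pos h1]
      split_ifs <;> norm_num
    · rw [if_neg h1, if_neg h1]
  refine (Finset.sum_le_sum h).trans ?_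
  rw [Finset.sum_const, nsmul_eq_mul, Finset.card_range]

/-- Each refinement adds at least 3/4 R² on live cells and nothing is lost on frozen ones. As the
live proportion only decreases, all earlier gains may be charged at the final proportion. -/
theorem energy_stoppedSlope_ge (hr : 2 ≤ r) (hb : Summable fun k : ℕ => |b k / (r : ℝ) ^ k|)
    (K : ℝ) (A n : ℕ) :
    3 / 4 * (∑ j ∈ Finset.range n, adicTail r b (j + 1) ^ 2) * (aliveCells r b K A n).card
      ≤ ∑ q ∈ Finset.Ico (-(r ^ n * A : ℤ)) (r ^ n * A), stoppedSlope r b K n q ^ 2 := by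
  have hr0 : (0 : ℝ) < r := by positivity
  induction n with
  | zero =>
    simp only [Finset.range_zero, Finset.sum_empty, mul_zero, zero_mul]
    exact Finset.sum_nonneg fun _ _ => sq_nonneg _
  | succ n ih =>
    rw [sum_Ico_pow_succ (by omega), Finset.sum_range_succ]
    set R := adicTail r b (n + 1)
    set S := ∑ j ∈ Finset.range n, adicTail r b (j + 1) ^ 2
    have hS : 0 ≤ S := Finset.sum_nonneg fun _ _ => sq_nonneg _
    have step : ∀ m ∈ Finset.Ico (-(r ^ n * A : ℤ)) (r ^ n * A),
        r * (stoppedSlope r b K n m ^ 2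
          + 3 / 4 * R ^ 2 * if |stoppedSlope r b K n m| ≤ K then 1 else 0)
        ≤ ∑ i ∈ Finset.range r, stoppedSlope r b K (n + 1) (r * m + i) ^ 2 := fun m _ => by
      by_cases h : |stoppedSlope r b K n m| ≤ K
      · rw [if_pos h, stoppedSlope_eq h, mul_one]
        refine (sum_cellSlope_succ_sq hr hb n m).1.trans (Finset.sum_le_sum fun i hi => ?_)
        rw [stoppedSlope, child_ediv (Finset.mem_range.1 hi), if_pos h]
      · rw [if_neg h, mul_zero, add_zero]
        refine le_of_eq ?_
        rw [Finset.sum_congr rfl fun i hi => by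
          rw [stoppedSlope, child_ediv (Finset.mem_range.1 hi), if_neg h], Finset.sum_const,
          nsmul_eq_mul, Finset.card_range]
    refine le_trans ?_ (Finset.sum_le_sum step)
    rw [← Finset.mul_sum, Finset.sum_add_distrib, ← Finset.mul_sum]
    have hcard : ∑ m ∈ Finset.Ico (-(r ^ n * A : ℤ)) (r ^ n * A),
        (if |stoppedSlope r b K n m| ≤ K then (1 : ℝ) else 0) = (aliveCells r b K A n).card := by
      rw [aliveCells, Finset.card_filter]
      push_cast
      rfl
    rw [hcard]
    have h1 := mul_le_mul_of_nonneg_left (card_aliveCells_succ_le (b := b) hr K A n)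
      (by positivity : 0 ≤ 3 / 4 * (S + R ^ 2))
    have h2 := mul_le_mul_of_nonneg_left ih hr0.le
    refine h1.trans ?_
    linarith

theorem floor_ediv (hr : 2 ≤ r) (n : ℕ) (x : ℝ) :
    ⌊2 * (r : ℝ) ^ (n + 1) * x⌋ / (r : ℤ) = ⌊2 * (r : ℝ) ^ n * x⌋ := by
  have hr0 : (0 : ℝ) < r := by positivity
  rw [← Int.floor_div_natCast]
  congr 1
  rw [pow_succ]
  field_simp

theorem stoppedSlope_floor (hr : 2 ≤ r) {K x : ℝ}
    (hx : ∀ n, |cellSlope r b n ⌊2 * (r : ℝ) ^ n * x⌋| ≤ K) (n : ℕ) :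
    stoppedSlope r b K n ⌊2 * (r : ℝ) ^ n * x⌋ = cellSlope r b n ⌊2 * (r : ℝ) ^ n * x⌋ := by
  induction n with
  | zero => rfl
  | succ n ih => rw [stoppedSlope, floor_ediv hr, ih, if_pos (hx n)]

theorem volume_bounded_cellSlope_le (hr : 2 ≤ r) (K : ℝ) (A n : ℕ) :
    volume {x : ℝ | |2 * x| < A ∧ ∀ n, |cellSlope r b n ⌊2 * (r : ℝ) ^ n * x⌋| ≤ K}
      ≤ ENNReal.ofReal ((aliveCells r b K A n).card / (2 * (r : ℝ) ^ n)) := by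
  have hr0 : (0 : ℝ) < r := by positivity
  have hc : (0 : ℝ) < 2 * (r : ℝ) ^ n := by positivity
  have hsub : {x : ℝ | |2 * x| < A ∧ ∀ n, |cellSlope r b n ⌊2 * (r : ℝ) ^ n * x⌋| ≤ K}
      ⊆ ⋃ q ∈ aliveCells r b K A n,
        Set.Icc ((q : ℝ) / (2 * (r : ℝ) ^ n)) (((q : ℝ) + 1) / (2 * (r : ℝ) ^ n)) := by
    rintro x ⟨hxA, hx⟩
    have hpow : (0 : ℝ) < (r : ℝ) ^ n := by positivity
    rw [abs_lt] at hxA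
    refine Set.mem_biUnion (x := ⌊2 * (r : ℝ) ^ n * x⌋) ?_ ⟨?_, ?_⟩
    · rw [SetLike.mem_coe, aliveCells, Finset.mem_filter, stoppedSlope_floor hr hx, Finset.mem_Ico,
        Int.le_floor, Int.floor_lt]
      refine ⟨⟨?_, ?_⟩, hx n⟩ <;> push_cast <;> nlinarith
    · rw [div_le_iff₀ hc, mul_comm]
      exact Int.floor_le _
    · rw [le_div_iff₀ hc, mul_comm]
      exact (Int.lt_floor_add_one _).le
  refine (measure_mono hsub).trans ((measure_biUnion_finset_le _ _).trans (le_of_eq ?_))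
  have hv : ∀ q : ℤ, volume (Set.Icc ((q : ℝ) / (2 * (r : ℝ) ^ n))
      (((q : ℝ) + 1) / (2 * (r : ℝ) ^ n))) = ENNReal.ofReal (1 / (2 * (r : ℝ) ^ n)) := fun q => by
    rw [Real.volume_Icc]
    congr 1
    ring
  simp_rw [hv]
  rw [Finset.sum_const, nsmul_eq_mul, ← ENNReal.ofReal_natCast, ← ENNReal.ofReal_mul (by positivity)]
  congr 1
  ring

/-- The stopped slopes are bounded by K + 4B, so their energy is bounded per cell; against the lower
bound of `energy_stoppedSlope_ge` with ∑ R² = ∞, the live proportion must tend to 0. -/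
theorem volume_bounded_cellSlope_eq_zero (hr : 2 ≤ r)
    (hb : Summable fun k : ℕ => |b k / (r : ℝ) ^ k|) {B : ℝ} (hB : ∀ k, |b k| ≤ B)
    (h2 : ¬ Summable fun k => b k ^ 2) {K : ℝ} (hK : 0 ≤ K) (A : ℕ) :
    volume {x : ℝ | |2 * x| < A ∧ ∀ n, |cellSlope r b n ⌊2 * (r : ℝ) ^ n * x⌋| ≤ K} = 0 := by
  have hr0 : (0 : ℝ) < r := by positivity
  have hC := abs_adicTail_le hr hB
  have hR : ¬ Summable fun j => adicTail r b (j + 1) ^ 2 := by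
    intro hs
    have hs0 : Summable fun j => adicTail r b j ^ 2 := (summable_nat_add_iff 1).1 hs
    refine h2 (Summable.of_nonneg_of_le (fun k => sq_nonneg _) (fun k => ?_)
      ((hs0.mul_left 2).add (hs.mul_left 2)))
    obtain ⟨e, he0, he1, he⟩ := exists_adicTail_recurrence hr hb k
    have : b k = adicTail r b k - e * adicTail r b (k + 1) := by linarith
    rw [this]
    have : e ^ 2 ≤ 1 := by nlinarith
    nlinarith [sq_nonneg (adicTail r b k + e * adicTail r b (k + 1)),
      mul_le_mul_of_nonneg_right this (sq_nonneg (adicTail r b (k + 1)))]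
  have hS := (not_summable_iff_tendsto_nat_atTop_of_nonneg
    (fun j => sq_nonneg (adicTail r b (j + 1)))).1 hR
  have hlim : Tendsto (fun n => ENNReal.ofReal (4 / 3 * A * (K + 2 * (2 * B)) ^ 2 /
      ∑ j ∈ Finset.range n, adicTail r b (j + 1) ^ 2)) atTop (𝓝 0) := by
    rw [← ENNReal.ofReal_zero]
    exact ENNReal.tendsto_ofReal (hS.const_div_atTop _)
  refine le_antisymm (ge_of_tendsto hlim ?_) zero_le
  filter_upwards [hS.eventually_gt_atTop 0] with n hn
  refine (volume_bounded_cellSlope_le hr K A n).trans (ENNReal.ofReal_le_ofReal ?_)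
  have h1 := energy_stoppedSlope_ge hr hb K A n
  have h3 : ∑ q ∈ Finset.Ico (-(r ^ n * A : ℤ)) (r ^ n * A), stoppedSlope r b K n q ^ 2
      ≤ 2 * (r : ℝ) ^ n * A * (K + 2 * (2 * B)) ^ 2 := by
    rw [← card_Ico_pow, ← nsmul_eq_mul]
    refine Finset.sum_le_card_nsmul _ _ _ fun q _ => ?_
    rw [← sq_abs]
    exact pow_le_pow_left₀ (abs_nonneg _) (abs_stoppedSlope_le hr hb hK hC n q) 2
  rw [div_le_div_iff₀ (by positivity) hn]
  linarith

theorem ae_not_differentiableAt_adicSeries (hr : 2 ≤ r)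
    (hb : Summable fun k : ℕ => |b k / (r : ℝ) ^ k|) {B : ℝ} (hB : ∀ k, |b k| ≤ B)
    (h2 : ¬ Summable fun k => b k ^ 2) :
    ∀ᵐ x : ℝ, ¬ DifferentiableAt ℝ (adicSeries r b) x := by
  have hnull : volume (⋃ A : ℕ, ⋃ K : ℕ, {x : ℝ | |2 * x| < A ∧
      ∀ n, |cellSlope r b n ⌊2 * (r : ℝ) ^ n * x⌋| ≤ K}) = 0 :=
    measure_iUnion_null fun A => measure_iUnion_null fun K =>
      volume_bounded_cellSlope_eq_zero hr hb hB h2 (Nat.cast_nonneg K) A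
  rw [ae_iff]
  refine measure_mono_null (fun x hx => ?_) hnull
  have hd : DifferentiableAt ℝ (adicSeries r b) x := not_not.1 hx
  have ht := (tendsto_cellSlope_of_hasDerivAt hr hd.hasDerivAt
    (fun n => ⌊2 * (r : ℝ) ^ n * x⌋) fun n => abs_floor_sub_le_one _).abs.bddAbove_range
  obtain ⟨K', hK'⟩ := ht
  obtain ⟨K, hK⟩ := exists_nat_ge K'
  obtain ⟨A, hA⟩ := exists_nat_gt |2 * x|
  simp only [Set.mem_iUnion]
  exact ⟨A, K, hA, fun n => (hK' ⟨n, rfl⟩).trans hK⟩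

end

/-! ### Signed sums with prescribed limit -/

/-- While t stays above the steps it decreases by w, which ∑ w = ∞ forbids forever; once t ≤ η/2
with all later w < η/2, it remains there. -/
theorem tendsto_zero_of_abs_sub_step {t w : ℕ → ℝ} (ht0 : ∀ n, 0 ≤ t n) (hw0 : ∀ n, 0 ≤ w n)
    (hw : Tendsto w atTop (𝓝 0)) (hs : ¬ Summable w) (ht : ∀ n, t (n + 1) = |t n - w n|) :
    Tendsto t atTop (𝓝 0) := by
  rw [Metric.tendsto_atTop]
  intro η hη
  obtain ⟨n0, hn0⟩ := (hw.eventually (gt_mem_nhds (half_pos hη))).exists_forall_of_atTop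
  obtain ⟨n1, hn1, hle⟩ : ∃ n1 ≥ n0, t n1 ≤ η / 2 := by
    by_contra! hcon
    refine hs ((summable_nat_add_iff n0).1
      (summable_of_sum_range_le (c := t n0) (fun _ => hw0 _) fun n => ?_))
    have h : ∀ n, ∑ i ∈ Finset.range n, w (i + n0) = t n0 - t (n + n0) := by
      intro n
      induction n with
      | zero => simp
      | succ n ih =>
        rw [Finset.sum_range_succ, ih, show n + 1 + n0 = n + n0 + 1 by ring, ht,
          abs_of_nonneg (by linarith [hcon (n + n0) (by omega), hn0 (n + n0) (by omega)])]
        ring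
    rw [h]
    linarith [ht0 (n + n0)]
  refine ⟨n1, fun n hn => ?_⟩
  have h : t n ≤ η / 2 := by
    induction n, hn using Nat.le_induction with
    | base => exact hle
    | succ n hn ih =>
      rw [ht, abs_le]
      constructor <;> linarith [ht0 n, hw0 n, hn0 n (by omega)]
  rw [Real.dist_eq, sub_zero, abs_of_nonneg (ht0 n)]
  linarith

/-- Partial sums of `±|v n|` with signs chosen to move towards `L`. -/
noncomputable def greedySum (v : ℕ → ℝ) (L : ℝ) : ℕ → ℝ
  | 0 => 0
  | n + 1 => if greedySum v L n ≤ L then greedySum v L n + |v n| else greedySum v L n - |v n|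

theorem exists_signs_tendsto {v : ℕ → ℝ} (hv : Tendsto v atTop (𝓝 0))
    (hs : ¬ Summable fun n => |v n|) (L : ℝ) :
    ∃ σ : ℕ → ℝ, (∀ n, σ n = 1 ∨ σ n = -1) ∧
      Tendsto (fun n => ∑ j ∈ Finset.range n, σ j * v j) atTop (𝓝 L) := by
  set s := greedySum v L
  have hs1 : ∀ n, s (n + 1) = if s n ≤ L then s n + |v n| else s n - |v n| := fun n => rfl
  have hσ : ∀ n, ∃ c : ℝ, (c = 1 ∨ c = -1) ∧ s (n + 1) = s n + c * v n := fun n => by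
    rw [hs1]
    rcases abs_choice (v n) with h | h <;> rw [h] <;> split_ifs
    · exact ⟨1, Or.inl rfl, by ring⟩
    · exact ⟨-1, Or.inr rfl, by ring⟩
    · exact ⟨-1, Or.inr rfl, by ring⟩
    · exact ⟨1, Or.inl rfl, by ring⟩
  choose σ h1 h2 using hσ
  refine ⟨σ, h1, ?_⟩
  have hsum : ∀ n, ∑ j ∈ Finset.range n, σ j * v j = s n := fun n => by
    induction n with
    | zero => rfl
    | succ n ih => rw [Finset.sum_range_succ, ih, h2]
  simp_rw [hsum]
  have key := tendsto_zero_of_abs_sub_step (t := fun n => |s n - L|) (w := fun n => |v n|)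
    (fun _ => abs_nonneg _) (fun _ => abs_nonneg _) (by simpa using hv.abs) hs fun n => ?_
  · rw [tendsto_iff_dist_tendsto_zero]
    exact key
  · simp only [hs1]
    split_ifs with h
    · rw [abs_of_nonpos (by linarith : s n - L ≤ 0), ← abs_neg]
      congr 1
      ring
    · rw [abs_of_nonneg (by linarith : 0 ≤ s n - L)]
      congr 1
      ring

/-- A sign pattern on three letters, not constant, for which the signed sum dominates. -/
theorem exists_nonconstant_pattern (u : ℕ → ℝ) :
    ∃ c : ℕ → ℝ, (∀ i, c i = 1 ∨ c i = -1) ∧ (∃ i < 3, c i = 1) ∧ (∃ i < 3, c i = -1) ∧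
      |u 0| + |u 1| + |u 2| ≤ 3 * |c 0 * u 0 + c 1 * u 1 + c 2 * u 2| := by
  have hc : ∀ k < 3, ∃ c : ℕ → ℝ, (∀ i, c i = 1 ∨ c i = -1) ∧ (∃ i < 3, c i = 1) ∧
      (∃ i < 3, c i = -1) ∧ c k = -1 ∧ (∀ i, i ≠ k → c i = 1) := fun k hk => by
    refine ⟨fun i => if i = k then -1 else 1, fun i => ?_, ?_, ⟨k, hk, by simp⟩, by simp,
      fun i hi => by simp [hi]⟩
    · simp only
      split_ifs <;> simp
    · by_cases h : k = 0
      · exact ⟨1, by norm_num, by simp [h]⟩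
      · exact ⟨0, by norm_num, by simp [Ne.symm h]⟩
  -- Let s_k be the sum with its single minus at k. Since s_j + s_k = 2u_i for distinct i, j, k, ∑
  -- |u_i| ≤ ∑ |s_k|, so some |s_k| is at least a third of ∑ |u_i|.
  by_contra! hcon
  obtain ⟨c0, a0, b0, d0, e0, f0⟩ := hc 0 (by norm_num)
  obtain ⟨c1, a1, b1, d1, e1, f1⟩ := hc 1 (by norm_num)
  obtain ⟨c2, a2, b2, d2, e2, f2⟩ := hc 2 (by norm_num)
  have h0 := hcon c0 a0 b0 d0
  have h1 := hcon c1 a1 b1 d1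
  have h2 := hcon c2 a2 b2 d2
  rw [e0, f0 1 (by norm_num), f0 2 (by norm_num)] at h0
  rw [e1, f1 0 (by norm_num), f1 2 (by norm_num)] at h1
  rw [e2, f2 0 (by norm_num), f2 1 (by norm_num)] at h2
  have g0 := abs_le.1 (le_refl |-1 * u 0 + 1 * u 1 + 1 * u 2|)
  have g1 := abs_le.1 (le_refl |1 * u 0 + -1 * u 1 + 1 * u 2|)
  have g2 := abs_le.1 (le_refl |1 * u 0 + 1 * u 1 + -1 * u 2|)
  rcases abs_cases (u 0) with k0 | k0 <;> rcases abs_cases (u 1) with k1 | k1 <;>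
    rcases abs_cases (u 2) with k2 | k2 <;> linarith

/-- The greedy choice is applied to block sums, so that flipping a whole block keeps it nonconstant.
Blocks of two would not do: only ±(u 0 - u 1) is available there, and it may vanish. -/
theorem exists_block_signs_tendsto {b : ℕ → ℝ} (hb : Tendsto b atTop (𝓝 0))
    (hs : ¬ Summable fun n => |b n|) (L : ℝ) :
    ∃ σ : ℕ → ℝ, (∀ n, σ n = 1 ∨ σ n = -1) ∧
      (∀ j, (∃ i < 3, σ (3 * j + i) = 1) ∧ ∃ i < 3, σ (3 * j + i) = -1) ∧
      Tendsto (fun n => ∑ k ∈ Finset.range n, σ k * b k) atTop (𝓝 L) := by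
  choose c c1 c2 c3 c4 using fun j : ℕ => exists_nonconstant_pattern fun i => b (3 * j + i)
  set v : ℕ → ℝ := fun j =>
    c j 0 * b (3 * j + 0) + c j 1 * b (3 * j + 1) + c j 2 * b (3 * j + 2) with hv
  have cabs : ∀ j i, |c j i| = 1 := fun j i => by rcases c1 j i with h | h <;> simp [h]
  have hsub : ∀ i, Tendsto (fun j => b (3 * j + i)) atTop (𝓝 0) := fun i =>
    hb.comp (tendsto_atTop_mono (fun j => by simp only [id]; omega) tendsto_id)
  have hcsub : ∀ i, Tendsto (fun j => c j i * b (3 * j + i)) atTop (𝓝 0) := fun i => by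
    refine squeeze_zero_norm (fun j => ?_) (by simpa using (hsub i).abs)
    rw [norm_mul, Real.norm_eq_abs, cabs, one_mul, Real.norm_eq_abs]
  have hv0 : Tendsto v atTop (𝓝 0) := by
    have h := ((hcsub 0).add (hcsub 1)).add (hcsub 2)
    rwa [add_zero, add_zero] at h
  have hvs : ¬ Summable fun n => |v n| := by
    intro h
    refine hs (summable_of_sum_range_le (c := 3 * ∑' n, |v n|) (fun _ => abs_nonneg _) fun n => ?_)
    have h1 : ∀ n, ∑ k ∈ Finset.range (3 * n), |b k| ≤ 3 * ∑ j ∈ Finset.range n, |v j| := by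
      intro n
      induction n with
      | zero => simp
      | succ n ih =>
        rw [show 3 * (n + 1) = 3 * n + 1 + 1 + 1 by ring, Finset.sum_range_succ,
          Finset.sum_range_succ, Finset.sum_range_succ, Finset.sum_range_succ]
        have := c4 n
        simp only [add_zero] at this
        simp only [hv, add_zero] at ih ⊢
        rw [add_assoc (3 * n) 1 1]
        linarith
    have h2 : ∑ k ∈ Finset.range n, |b k| ≤ ∑ k ∈ Finset.range (3 * n), |b k| :=
      Finset.sum_le_sum_of_subset_of_nonneg (Finset.range_mono (by omega))
        fun _ _ _ => abs_nonneg _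
    have h3 := h.sum_le_tsum (Finset.range n) fun _ _ => abs_nonneg _
    linarith [h1 n]
  obtain ⟨τ, τ1, τ2⟩ := exists_signs_tendsto hv0 hvs L
  refine ⟨fun k => τ (k / 3) * c (k / 3) (k % 3), fun n => ?_, fun j => ?_, ?_⟩
  · rcases τ1 (n / 3) with h | h <;> rcases c1 (n / 3) (n % 3) with h' | h' <;> simp [h, h']
  · have e : ∀ i < 3, τ ((3 * j + i) / 3) * c ((3 * j + i) / 3) ((3 * j + i) % 3)
        = τ j * c j i := fun i hi => by
      rw [show (3 * j + i) / 3 = j by omega, show (3 * j + i) % 3 = i by omega]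
    obtain ⟨i, hi, h⟩ := c2 j
    obtain ⟨i', hi', h'⟩ := c3 j
    rcases τ1 j with ht | ht
    · exact ⟨⟨i, hi, by simp only [e i hi, h, ht, mul_one]⟩,
        ⟨i', hi', by simp only [e i' hi', h', ht, one_mul]⟩⟩
    · exact ⟨⟨i', hi', by simp only [e i' hi', h', ht]; norm_num⟩,
        ⟨i, hi, by simp only [e i hi, h, ht, mul_one]⟩⟩
  · set σ : ℕ → ℝ := fun k => τ (k / 3) * c (k / 3) (k % 3) with hσ
    have hσabs : ∀ k, |σ k| = 1 := fun k => by
      rw [hσ]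
      simp only
      rw [abs_mul, cabs]
      rcases τ1 (k / 3) with h | h <;> simp [h]
    have hblock : ∀ n, ∑ k ∈ Finset.range (3 * n), σ k * b k
        = ∑ j ∈ Finset.range n, τ j * v j := by
      intro n
      induction n with
      | zero => simp
      | succ n ih =>
        rw [show 3 * (n + 1) = 3 * n + 1 + 1 + 1 by ring, Finset.sum_range_succ,
          Finset.sum_range_succ, Finset.sum_range_succ, Finset.sum_range_succ, ih]
        simp only [hσ, hv, add_zero]
        rw [show (3 * n) / 3 = n by omega, show (3 * n) % 3 = 0 by omega,
          show (3 * n + 1) / 3 = n by omega, show (3 * n + 1) % 3 = 1 by omega,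
          add_assoc (3 * n) 1 1,
          show (3 * n + (1 + 1)) / 3 = n by omega, show (3 * n + (1 + 1)) % 3 = 2 by omega]
        ring
    have hdiv : Tendsto (fun n : ℕ => n / 3) atTop atTop :=
      Nat.tendsto_div_const_atTop (by norm_num)
    have hmain := τ2.comp hdiv
    -- A partial sum exceeds the last complete block by at most two terms.
    have herr : Tendsto (fun n : ℕ => |b (3 * (n / 3) + 0)| + |b (3 * (n / 3) + 1)|) atTop
        (𝓝 0) := by
      have h := ((hsub 0).abs.add (hsub 1).abs).comp hdiv
      rwa [abs_zero, add_zero] at h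
    refine tendsto_of_tendsto_of_dist hmain (squeeze_zero (fun _ => dist_nonneg) (fun n => ?_) herr)
    simp only [Function.comp_apply]
    rw [← hblock, dist_comm, Real.dist_eq]
    have hmod : n % 3 = 0 ∨ n % 3 = 1 ∨ n % 3 = 2 := by omega
    have hn : n = 3 * (n / 3) + n % 3 := by omega
    generalize n / 3 = p at hn ⊢
    have term : ∀ k, |σ k * b k| = |b k| := fun k => by rw [abs_mul, hσabs, one_mul]
    rcases hmod with h | h | h <;> rw [h] at hn <;> subst hn
    · simp
      positivity
    · rw [Finset.sum_range_succ, add_sub_cancel_left, term, add_zero]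
      linarith [abs_nonneg (b (3 * p + 1))]
    · rw [show 3 * p + 2 = 3 * p + 1 + 1 by ring, Finset.sum_range_succ, Finset.sum_range_succ,
        add_assoc, add_sub_cancel_left]
      refine (abs_add_le _ _).trans ?_
      rw [term, term, add_zero]

/-! ### Points with prescribed digits and their derivatives -/

/-- The number with base-`r` digits `D k, D (k+1), …` after the point. -/
noncomputable def digitTail (r : ℕ) (D : ℕ → ℕ) (k : ℕ) : ℝ :=
  ∑' l : ℕ, (D (k + l) : ℝ) / (r : ℝ) ^ (l + 1)

section
variable {r : ℕ} {D : ℕ → ℕ}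

theorem hasSum_max_digit (hr : 2 ≤ r) :
    HasSum (fun l : ℕ => ((r : ℝ) - 1) / (r : ℝ) ^ (l + 1)) 1 := by
  have hr1 : (1 : ℝ) < r := by exact_mod_cast hr
  have h := (hasSum_geometric_of_lt_one (inv_nonneg.2 (by linarith : (0 : ℝ) ≤ r))
    (inv_lt_one_of_one_lt₀ hr1)).mul_left (((r : ℝ) - 1) / r)
  have e : ((r : ℝ) - 1) / r * (1 - (r : ℝ)⁻¹)⁻¹ = 1 := by
    have h1 : (r : ℝ) ≠ 0 := by linarith
    have h2 : (r : ℝ) - 1 ≠ 0 := by linarith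
    have h3 : 1 - (r : ℝ)⁻¹ = ((r : ℝ) - 1) / r := by field_simp
    rw [h3]
    exact mul_inv_cancel₀ (div_ne_zero h2 h1)
  rw [e] at h
  refine h.congr_fun fun l => ?_
  rw [pow_succ, inv_pow]
  field_simp

theorem hasSum_digitTail (hr : 2 ≤ r) (hD : ∀ k, D k ≤ r - 1) (k : ℕ) :
    HasSum (fun l : ℕ => (D (k + l) : ℝ) / (r : ℝ) ^ (l + 1)) (digitTail r D k) := by
  refine (Summable.of_nonneg_of_le (fun l => by positivity) (fun l => ?_)
    (hasSum_max_digit hr).summable).hasSum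
  have h : (D (k + l) : ℝ) ≤ r - 1 := by
    have : ((D (k + l) : ℕ) : ℝ) ≤ ((r - 1 : ℕ) : ℝ) := by exact_mod_cast hD _
    rwa [Nat.cast_sub (by omega), Nat.cast_one] at this
  gcongr

theorem mul_digitTail (hr : 2 ≤ r) (hD : ∀ k, D k ≤ r - 1) (k : ℕ) :
    r * digitTail r D k = D k + digitTail r D (k + 1) := by
  have hr0 : (0 : ℝ) < r := by positivity
  have h := (hasSum_digitTail hr hD k).summable.sum_add_tsum_nat_add 1
  rw [digitTail, ← h, Finset.sum_range_one, mul_add, digitTail, ← tsum_mul_left]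
  congr 1
  · simp
    field_simp
  · refine tsum_congr fun l => ?_
    rw [add_comm l 1, ← add_assoc, pow_succ, add_comm 1 l, pow_succ]
    field_simp

theorem digitTail_compl (hr : 2 ≤ r) (hD : ∀ k, D k ≤ r - 1) (k : ℕ) :
    digitTail r (fun k => r - 1 - D k) k = 1 - digitTail r D k := by
  have h := (hasSum_max_digit hr).sub (hasSum_digitTail hr hD k)
  rw [digitTail, ← h.tsum_eq]
  refine tsum_congr fun l => ?_
  rw [Nat.cast_sub (hD _), Nat.cast_sub (by omega), Nat.cast_one, sub_div]

/-- A digit tail is bounded below if every block of three digits has a nonzero one. -/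
theorem digitTail_lower (hr : 2 ≤ r) (hD : ∀ k, D k ≤ r - 1)
    (hblock : ∀ j, ∃ i < 3, D (3 * j + i) ≠ 0) (k : ℕ) :
    1 / (r : ℝ) ^ 6 ≤ digitTail r D k := by
  have hr1 : (1 : ℝ) ≤ r := by exact_mod_cast (by omega : 1 ≤ r)
  -- The first block starting at or after k ends by k + 4, so exponent 6 is ample.
  obtain ⟨i, hi, h⟩ := hblock ((k + 2) / 3)
  obtain ⟨l, hl, hl5⟩ : ∃ l, k + l = 3 * ((k + 2) / 3) + i ∧ l + 1 ≤ 6 :=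
    ⟨3 * ((k + 2) / 3) + i - k, by omega, by omega⟩
  rw [← hl] at h
  have h1 : (1 : ℝ) ≤ D (k + l) := by exact_mod_cast Nat.one_le_iff_ne_zero.2 h
  calc 1 / (r : ℝ) ^ 6 ≤ D (k + l) / (r : ℝ) ^ (l + 1) := by gcongr
    _ ≤ digitTail r D k := le_hasSum (hasSum_digitTail hr hD k) l fun j _ => by positivity

theorem exists_int_add_digitTail (hr : 2 ≤ r) (hD : ∀ k, D k ≤ r - 1) (k : ℕ) :
    ∃ n : ℤ, (r : ℝ) ^ k * digitTail r D 0 = n + digitTail r D k := by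
  induction k with
  | zero => exact ⟨0, by simp⟩
  | succ k ih =>
    obtain ⟨n, hn⟩ := ih
    refine ⟨r * n + D k, ?_⟩
    have := mul_digitTail hr hD k
    push_cast
    rw [pow_succ]
    linear_combination (r : ℝ) * hn + this

/-- Given signs that are not constant on any block of three indices, there is a point around which
each `x ↦ d(r^k x)` is affine, on a scale comparable to `r^{-k}`, with the prescribed slope sign. -/
theorem exists_point_of_signs (hr : 2 ≤ r) {σ : ℕ → ℝ} (hσ : ∀ n, σ n = 1 ∨ σ n = -1)
    (hblock : ∀ j, (∃ i < 3, σ (3 * j + i) = 1) ∧ ∃ i < 3, σ (3 * j + i) = -1) :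
    ∃ x δ : ℝ, 0 < δ ∧ ∀ (k : ℕ) (t : ℝ), |t| ≤ δ →
      distInt ((r : ℝ) ^ k * x + t) - distInt ((r : ℝ) ^ k * x) = σ k * t := by
  have hr0 : (0 : ℝ) < r := by positivity
  have hr2 : (2 : ℝ) ≤ r := by exact_mod_cast hr
  set D : ℕ → ℕ := fun k => if σ k = 1 then 0 else r - 1 with hDdef
  have hD : ∀ k, D k ≤ r - 1 := fun k => by
    simp only [hDdef]
    split_ifs <;> omega
  have hneg : ∀ k, σ k = -1 → D k = r - 1 := fun k h => by
    simp only [hDdef]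
    rw [if_neg (by rw [h]; norm_num)]
  have hpos : ∀ k, σ k = 1 → D k = 0 := fun k h => by
    simp only [hDdef]
    rw [if_pos h]
  have low : ∀ k, 1 / (r : ℝ) ^ 6 ≤ digitTail r D k := digitTail_lower hr hD fun j => by
    obtain ⟨i, hi, h⟩ := (hblock j).2
    exact ⟨i, hi, by rw [hneg _ h]; omega⟩
  have high : ∀ k, 1 / (r : ℝ) ^ 6 ≤ 1 - digitTail r D k := fun k => by
    rw [← digitTail_compl hr hD]
    refine digitTail_lower hr (fun k => by omega) (fun j => ?_) k
    obtain ⟨i, hi, h⟩ := (hblock j).1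
    exact ⟨i, hi, by rw [hpos _ h]; omega⟩
  set δ := 1 / (r : ℝ) ^ 6 with hδ
  have hδ0 : 0 < δ := by positivity
  -- The fractional part y of r^k x lies in [δ, (1 - δ)/2] for digit 0, and 1 - y does for digit r -
  -- 1; a shift by δ/2 crosses no corner.
  refine ⟨digitTail r D 0, δ / 2, by positivity, fun k t ht => ?_⟩
  obtain ⟨n, hn⟩ := exists_int_add_digitTail hr hD k
  have hmul := mul_digitTail hr hD k
  have h1 := low k
  have h2 := high k
  have h3 := high (k + 1)
  have h4 := low (k + 1)
  rw [abs_le] at ht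
  rw [hn, add_assoc, distInt_int_add, distInt_int_add]
  set y := digitTail r D k
  rcases hσ k with h | h
  · rw [hpos k h, Nat.cast_zero, zero_add] at hmul
    have hy : 2 * y ≤ 1 - δ := by nlinarith
    rw [h, distInt_eq_self (by linarith) (by linarith), distInt_eq_self (by linarith) (by linarith)]
    ring
  · rw [hneg k h, Nat.cast_sub (by omega), Nat.cast_one] at hmul
    have hy : 2 * (1 - y) ≤ 1 - δ := by nlinarith
    rw [h, distInt_eq_one_sub (by linarith) (by linarith),
      distInt_eq_one_sub (by linarith) (by linarith)]
    ring

/-- For an increment h, cut at the first n with |h| r^n > δ: earlier terms contribute exactly σ_k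
b_k h, and later ones are O(sup |b| / r^n) = o(|h|), since n grows as h → 0. -/
theorem hasDerivAt_adicSeries_of_affine {b σ : ℕ → ℝ} (hr : 2 ≤ r)
    (hb : Summable fun k : ℕ => |b k / (r : ℝ) ^ k|) (hb0 : Tendsto b atTop (𝓝 0)) {L x δ : ℝ}
    (hδ : 0 < δ) (hx : ∀ (k : ℕ) (t : ℝ), |t| ≤ δ →
      distInt ((r : ℝ) ^ k * x + t) - distInt ((r : ℝ) ^ k * x) = σ k * t)
    (hL : Tendsto (fun n => ∑ k ∈ Finset.range n, σ k * b k) atTop (𝓝 L)) :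
    HasDerivAt (adicSeries r b) L x := by
  have hr0 : (0 : ℝ) < r := by positivity
  have hr2 : (2 : ℝ) ≤ r := by exact_mod_cast hr
  have hr1 : (1 : ℝ) < r := by linarith
  rw [hasDerivAt_iff_isLittleO_nhds_zero, Asymptotics.isLittleO_iff]
  intro η hη
  -- The tail is at most 2β/r^n < 2β|h|/δ = η|h|/2.
  set β := η * δ / 4 with hβ
  have hβ0 : 0 < β := by positivity
  obtain ⟨N1, hN1⟩ := ((Metric.tendsto_nhds.1 hL) (η / 2) (by positivity)).exists_forall_of_atTop
  obtain ⟨N2, hN2⟩ := ((Metric.tendsto_nhds.1 hb0) β hβ0).exists_forall_of_atTop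
  set N := max N1 N2 with hN
  have hball : ∀ᶠ h : ℝ in 𝓝 0, |h| < δ / (r : ℝ) ^ N := by
    have := Metric.ball_mem_nhds (0 : ℝ) (by positivity : 0 < δ / (r : ℝ) ^ N)
    filter_upwards [this] with h hh
    simpa using hh
  filter_upwards [hball] with h hh
  rcases eq_or_ne h 0 with rfl | hne
  · simp
  have hpos : 0 < |h| := abs_pos.2 hne
  have hex : ∃ n : ℕ, δ < |h| * (r : ℝ) ^ n := by
    obtain ⟨n, hn⟩ := pow_unbounded_of_one_lt (δ / |h|) hr1
    exact ⟨n, by rwa [div_lt_iff₀ hpos, mul_comm] at hn⟩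
  classical
  set n := Nat.find hex with hnd
  have hn := Nat.find_spec hex
  rw [← hnd] at hn
  have hlt : ∀ k < n, |h| * (r : ℝ) ^ k ≤ δ := fun k hk => not_lt.1 (Nat.find_min hex hk)
  have hNn : N ≤ n := by
    by_contra! hcon
    have h1 : (r : ℝ) ^ n ≤ (r : ℝ) ^ N := pow_le_pow_right₀ hr1.le hcon.le
    rw [lt_div_iff₀ (by positivity)] at hh
    nlinarith
  have hsplit : adicSeries r b (x + h) - adicSeries r b x
      = (∑ k ∈ Finset.range n, σ k * b k) * h + ∑' l : ℕ, b (l + n) *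
        (distInt ((r : ℝ) ^ (l + n) * (x + h)) - distInt ((r : ℝ) ^ (l + n) * x))
          / (r : ℝ) ^ (l + n) := by
    have s1 := summable_adicSeries hb (x + h)
    have s2 := summable_adicSeries hb x
    rw [adicSeries, adicSeries, ← s1.tsum_sub s2, ← (s1.sub s2).sum_add_tsum_nat_add n,
      Finset.sum_mul]
    congr 1
    · refine Finset.sum_congr rfl fun k hk => ?_
      have hk' := hlt k (Finset.mem_range.1 hk)
      have h1 := hx k ((r : ℝ) ^ k * h) (by
        rw [abs_mul, abs_of_pos (by positivity : (0 : ℝ) < r ^ k)]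
        linarith)
      rw [← mul_add] at h1
      rw [← mul_sub, ← sub_div, h1]
      field_simp
    · refine tsum_congr fun l => ?_
      ring
  have htail : ‖∑' l : ℕ, b (l + n) *
        (distInt ((r : ℝ) ^ (l + n) * (x + h)) - distInt ((r : ℝ) ^ (l + n) * x))
          / (r : ℝ) ^ (l + n)‖ ≤ β / (r : ℝ) ^ n * 2 := by
    refine tsum_of_norm_bounded (hasSum_geometric_two.mul_left _) fun l => ?_
    have h1 : |b (l + n)| ≤ β := by
      have := hN2 (l + n) ((le_max_right N1 N2).trans (hNn.trans (by omega)))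
      rw [Real.dist_eq, sub_zero] at this
      exact this.le
    have h2 : |distInt ((r : ℝ) ^ (l + n) * (x + h)) - distInt ((r : ℝ) ^ (l + n) * x)| ≤ 1 := by
      rw [abs_le]
      constructor <;>
        linarith [distInt_nonneg ((r : ℝ) ^ (l + n) * (x + h)), distInt_nonneg ((r : ℝ) ^ (l + n) * x),
          distInt_le_half ((r : ℝ) ^ (l + n) * (x + h)), distInt_le_half ((r : ℝ) ^ (l + n) * x)]
    have h3 : (1 : ℝ) / r ^ l ≤ (1 / 2) ^ l := by
      rw [one_div_pow]
      exact one_div_le_one_div_of_le (by positivity) (pow_le_pow_left₀ (by norm_num) hr2 l)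
    rw [Real.norm_eq_abs, abs_div, abs_mul, abs_of_pos (by positivity : (0 : ℝ) < r ^ (l + n))]
    calc _ ≤ β * 1 / (r : ℝ) ^ (l + n) := by gcongr
      _ = β / (r : ℝ) ^ n * (1 / (r : ℝ) ^ l) := by
        rw [pow_add]
        field_simp
      _ ≤ _ := mul_le_mul_of_nonneg_left h3 (by positivity)
  have hS := hN1 n ((le_max_left N1 N2).trans hNn)
  rw [Real.dist_eq] at hS
  set T := ∑' l : ℕ, b (l + n) *
        (distInt ((r : ℝ) ^ (l + n) * (x + h)) - distInt ((r : ℝ) ^ (l + n) * x))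
          / (r : ℝ) ^ (l + n)
  have e : adicSeries r b (x + h) - adicSeries r b x - h • L
      = ((∑ k ∈ Finset.range n, σ k * b k) - L) * h + T := by
    rw [hsplit, smul_eq_mul]
    ring
  rw [e, Real.norm_eq_abs, Real.norm_eq_abs]
  refine (abs_add_le _ _).trans ?_
  rw [abs_mul]
  rw [Real.norm_eq_abs] at htail
  have h5 : β / (r : ℝ) ^ n * 2 ≤ η / 2 * |h| := by
    rw [div_mul_eq_mul_div, div_le_iff₀ (by positivity), hβ]
    nlinarith
  have h6 := mul_le_mul_of_nonneg_right hS.le hpos.le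
  linarith

end

/-! ### Range of the derivative and the main theorem -/

theorem not_summable_abs_of_not_summable_sq {b : ℕ → ℝ} (hb : Tendsto b atTop (𝓝 0))
    (h2 : ¬ Summable fun k => b k ^ 2) : ¬ Summable fun k => |b k| := by
  intro h
  refine h2 (h.of_norm_bounded_eventually_nat ?_)
  filter_upwards [(Metric.tendsto_nhds.1 hb) 1 one_pos] with k hk
  rw [Real.dist_eq, sub_zero] at hk
  rw [norm_pow, Real.norm_eq_abs]
  nlinarith [abs_nonneg (b k)]

theorem deriv_adicSeries_image {r : ℕ} {b : ℕ → ℝ} (hr : 2 ≤ r)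
    (hb : Summable fun k : ℕ => |b k / (r : ℝ) ^ k|) (hb0 : Tendsto b atTop (𝓝 0))
    (h2 : ¬ Summable fun k => b k ^ 2) :
    deriv (adicSeries r b) '' {x : ℝ | DifferentiableAt ℝ (adicSeries r b) x} = Set.univ := by
  refine Set.eq_univ_of_forall fun L => ?_
  obtain ⟨σ, h1, h3, h4⟩ :=
    exists_block_signs_tendsto hb0 (not_summable_abs_of_not_summable_sq hb0 h2) L
  obtain ⟨x, δ, hδ, hx⟩ := exists_point_of_signs hr h1 h3
  have hd := hasDerivAt_adicSeries_of_affine hr hb hb0 hδ hx h4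
  exact ⟨x, hd.differentiableAt, hd.deriv⟩

theorem mk_eq_continuum_of_image_eq_univ {f : ℝ → ℝ} {s : Set ℝ} (h : f '' s = Set.univ) :
    Cardinal.mk s = Cardinal.continuum := by
  refine le_antisymm ?_ ?_
  · rw [← Cardinal.mk_real]
    exact Cardinal.mk_set_le s
  · rw [← Cardinal.mk_univ_real, ← h]
    exact Cardinal.mk_image_le

theorem theorem2p4 (r : ℕ) (hr : 2 ≤ r) (a : ℕ → ℝ)
    (ha : Summable fun k : ℕ => |a (k + 1) / (r : ℝ) ^ k|) :
    Continuous (takagiVdW r a) ∧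
    ((Summable fun k : ℕ => a (k + 1) ^ 2) →
      (∀ u v : ℝ, AbsolutelyContinuousOnInterval (takagiVdW r a) u v) ∧
      ∀ᵐ x : ℝ, DifferentiableAt ℝ (takagiVdW r a) x) ∧
    ((¬ Summable fun k : ℕ => a (k + 1) ^ 2) → Tendsto a atTop (𝓝 0) →
      Cardinal.mk {x : ℝ | DifferentiableAt ℝ (takagiVdW r a) x} = Cardinal.continuum ∧
      deriv (takagiVdW r a) '' {x : ℝ | DifferentiableAt ℝ (takagiVdW r a) x} = Set.univ ∧
      ∀ᵐ x : ℝ, ¬ DifferentiableAt ℝ (takagiVdW r a) x) ∧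
    (0 < limsup (fun k : ℕ => ((|a k| : ℝ) : EReal)) atTop →
      ∀ x : ℝ, ¬ DifferentiableAt ℝ (takagiVdW r a) x) := by
  rw [takagiVdW_eq_adicSeries]
  refine ⟨continuous_adicSeries ha, fun h2 => ?_, fun h2 h0 => ?_, fun hlim x hx => ?_⟩
  · have hac := absolutelyContinuousOnInterval_adicSeries hr ha h2
    exact ⟨hac, ae_differentiableAt_of_absolutelyContinuousOnInterval hac⟩
  · have hb0 : Tendsto (fun k => a (k + 1)) atTop (𝓝 0) := (tendsto_add_atTop_iff_nat 1).2 h0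
    have himage := deriv_adicSeries_image hr ha hb0 h2
    obtain ⟨B, hB⟩ := hb0.abs.bddAbove_range
    exact ⟨mk_eq_continuum_of_image_eq_univ himage, himage,
      ae_not_differentiableAt_adicSeries hr ha (fun k => hB ⟨k, rfl⟩) h2⟩
  -- One point of differentiability already forces a → 0, so the limsup is 0; `EReal` accommodates
  -- the value +∞.
  · have h0 : Tendsto a atTop (𝓝 0) :=
      (tendsto_add_atTop_iff_nat 1).1 (tendsto_zero_of_differentiableAt hr ha hx)
    have habs : Tendsto (fun k : ℕ => ((|a k| : ℝ) : EReal)) atTop (𝓝 ((0 : ℝ) : EReal)) :=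
      (continuous_coe_real_ereal.tendsto 0).comp (by simpa using h0.abs)
    rw [habs.limsup_eq] at hlim
    exact lt_irrefl _ hlim
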